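/- Fix $p\in(0,1/2)$, let $\Theta$ be a compact subset of $(0,p)$, and for $a\in\Theta$ let $\nu_a=p\,\delta_a+(1-p)\,\delta_{1-a}$. Let $(X_t)_{t\ge 0}$ be the nearest-neighbour random walk on $\mathbb Z$ started at $0$ in the i.i.d. environment $\omega=(\omega_x)_{x\in\mathbb Z}$ with marginal $\nu_{a^\star}$, $a^\star\in\Theta$ (from $x$ it jumps to $x+1$ with probability $\omega_x$ and to $x-1$ with probability $1-\omega_x$), and let $\mathbf P^\star$ be its annealed law. Let $T_n=\inf\{t\in\mathbb N: X_t=n\}$, $L^n_x=\sum_{t=0}^{T_n-1}\mathbf 1\{X_t=x,\,X_{t+1}=x-1\}$, and, for $u,v\in\mathbb Z_+$, $$\phi_a(u,v)=\log\int x^{u+1}(1-x)^v\,d\nu_a(x),\qquad Q_a(u,v)=\binom{u+v}{v}\int x^{u+1}(1-x)^v\,d\nu_a(x).$$ Let $\pi_a(u)=\mathbb E^a[S(1-S)^u]$ with $S=\big(\sum_{k\ge0}\prod_{i=1}^k\frac{1-\omega_i}{\omega_i}\big)^{-1}$, where $\mathbb E^a$ is the expectation over the i.i.d. environment with marginal $\nu_a$;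 let $\tilde\pi_a(u,v)=\pi_a(u)Q_a(u,v)$ and $\tilde\pi_a(g)=\sum_{u,v}\tilde\pi_a(u,v)g(u,v)\in[0,\infty]$ for $g\ge0$. Let $\phi_a'$ be the derivative of $\phi_a$ with respect to $a$. (a) For $\alpha>0$ let $\mathcal V_\alpha=\{a\in\Theta: d_{\mathrm{KL}}(a^\star|a)\le\alpha\}$, where $d_{\mathrm{KL}}(q|q')=q\log\frac q{q'}+(1-q)\log\frac{1-q}{1-q'}$. Then, for every $\alpha>0$, as $n\to\infty$, $$\frac1n\sum_{x=0}^{n-1}\ \sup_{a\in\Theta\setminus\mathcal V_\alpha}\big[\phi_a(L^n_{x+1},L^n_x)-\phi_{a^\star}(L^n_{x+1},L^n_x)\big]\longrightarrow-\infty\quad\text{in }\mathbf P^\star\text{-probability}$$ (with $\sup\emptyset=-\infty$). Moreover the maximum likelihood estimator of $a$ is consistent: for every $a_0\in\Theta$ and every measurable choice of a maximizer $\widehat a_n$ over $\Theta$ of $a\mapsto\sum_{x=0}^{n-1}[\phi_a(L^n_{x+1},L^n_x)-\phi_{a_0}(L^n_{x+1},L^n_x)]$, $\widehat a_n\to a^\star$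 in $\mathbf P^\star$-probability. (b) The Fisher information is infinite: for every $a\in\Theta$, $\Sigma_a=\tilde\pi_a\big((\phi_a')^2\big)=+\infty$. (c) For every $a\in\Theta$ with $a\ne a^\star$, $\tilde\pi_{a^\star}\big(|\phi_a'|\big)=+\infty$. Moreover, if $\Theta$ has at least two points, then for every $a_0\in\Theta$ the uniform integrability condition "$\tilde\pi_a\big(\sup_{a'\in\Theta}|\phi_{a'}-\phi_{a_0}|\big)<\infty$ for every $a\in\Theta$" fails. -/

import Mathlib

noncomputable section

namespace RWRE

open MeasureTheory ProbabilityTheory Set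

open scoped ENNReal

/-- An environment on `ℤ`: at each site `x`, the probability `ω x ∈ (0,1)` of jumping to the
right. -/
abbrev Env : Type := ℤ → Ioo (0 : ℝ) 1

/-- The law of one step of the walk from `x` in the environment `ω`: to `x + 1` with probability
`ω x`, to `x - 1` with probability `1 - ω x`. -/
def stepLaw (ω : Env) (x : ℤ) : Measure ℤ :=
  ENNReal.ofReal (ω x : ℝ) • Measure.dirac (x + 1)
    + ENNReal.ofReal (1 - (ω x : ℝ)) • Measure.dirac (x - 1)

instance (ω : Env) (x : ℤ) : IsProbabilityMeasure (stepLaw ω x) := by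
  refine ⟨?_⟩
  have h := (ω x).2
  simp only [stepLaw, Measure.add_apply, Measure.smul_apply, smul_eq_mul, measure_univ, mul_one]
  rw [← ENNReal.ofReal_add h.1.le (by linarith [h.2])]
  simp

/-- The transition kernel of the walk at time `n`: it depends on the past `(X 0, …, X n)` through
`X n` only. -/
def stepKernel (ω : Env) (n : ℕ) : Kernel ((i : Finset.Iic n) → ℤ) ℤ where
  toFun h := stepLaw ω (h ⟨n, Finset.mem_Iic.2 le_rfl⟩)
  measurable' := (measurable_of_countable (stepLaw ω)).comp (measurable_pi_apply _)

instance (ω : Env) (n : ℕ) : IsMarkovKernel (stepKernel ω n) :=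
  ⟨fun h ↦ inferInstanceAs
    (IsProbabilityMeasure (stepLaw ω (h ⟨n, Finset.mem_Iic.2 le_rfl⟩)))⟩

/-- The quenched law `P_ω`: the law on the path space `ℕ → ℤ` of the Markov chain started at `0`
with transition probabilities given by `stepLaw ω`. -/
def quenchedLaw (ω : Env) : Measure (ℕ → ℤ) :=
  Kernel.trajMeasure (X := fun _ ↦ ℤ) (Measure.dirac (0 : ℤ)) (stepKernel ω)

instance (ω : Env) : IsProbabilityMeasure (quenchedLaw ω) := by
  unfold quenchedLaw; infer_instance

theorem measurable_stepLaw (x y : ℤ) : Measurable fun ω : Env ↦ stepLaw ω x {y} := by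
  simp only [stepLaw, Measure.add_apply, Measure.smul_apply, smul_eq_mul]
  fun_prop

theorem quenchedLaw_zero (ω : Env) (x : ℕ → ℤ) :
    quenchedLaw ω {X | ∀ i ≤ 0, X i = x i} = Measure.dirac (0 : ℤ) {x 0} := by
  have hset : {X : ℕ → ℤ | ∀ i ≤ 0, X i = x i}
      = Preorder.frestrictLe (π := fun _ ↦ ℤ) 0 ⁻¹' {h | h ⟨0, by simp⟩ = x 0} := by
    ext X; simp
  have hm : MeasurableSet {h : (i : Finset.Iic 0) → ℤ | h ⟨0, by simp⟩ = x 0} :=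
    MeasurableSet.of_discrete
  rw [hset, ← Measure.map_apply (by fun_prop) hm, quenchedLaw, Kernel.trajMeasure,
    Measure.map_comp _ _ (by fun_prop), Kernel.traj_map_frestrictLe, Kernel.partialTraj_self,
    Measure.id_comp, Measure.map_apply (by fun_prop) hm]
  rfl

theorem quenchedLaw_succ (ω : Env) (n : ℕ) (x : ℕ → ℤ) :
    quenchedLaw ω {X | ∀ i ≤ n + 1, X i = x i}
      = quenchedLaw ω {X | ∀ i ≤ n, X i = x i} * stepLaw ω (x n) {x (n + 1)} := by
  have h := Kernel.map_frestrictLe_trajMeasure_compProd_eq_map_trajMeasure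
    (X := fun _ ↦ ℤ) (μ₀ := Measure.dirac (0 : ℤ)) (κ := stepKernel ω) (a := n)
  have h1 := congrArg (fun μ : Measure (((i : Finset.Iic n) → ℤ) × ℤ) ↦ μ (({fun i : Finset.Iic n ↦ x i} : Set ((i : Finset.Iic n) → ℤ)) ×ˢ ({x (n + 1)} : Set ℤ))) h
  have hm : MeasurableSet ({fun i : Finset.Iic n ↦ x i} : Set ((i : Finset.Iic n) → ℤ)) :=
    MeasurableSet.singleton _
  rw [Measure.compProd_apply_prod hm (MeasurableSet.singleton _), lintegral_singleton,
    Measure.map_apply (by fun_prop) hm,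
    Measure.map_apply (by fun_prop) (hm.prod (MeasurableSet.singleton _))] at h1
  have e1 : (Preorder.frestrictLe (π := fun _ ↦ ℤ) n ⁻¹' {fun i : Finset.Iic n ↦ x i})
      = {X : ℕ → ℤ | ∀ i ≤ n, X i = x i} := by
    ext X; simp [funext_iff]
  have e2 : ((fun X : ℕ → ℤ ↦ (Preorder.frestrictLe (π := fun _ ↦ ℤ) n X, X (n + 1))) ⁻¹'
      (({fun i : Finset.Iic n ↦ x i} : Set ((i : Finset.Iic n) → ℤ)) ×ˢ ({x (n + 1)} : Set ℤ))) = {X : ℕ → ℤ | ∀ i ≤ n + 1, X i = x i} := by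
    ext X
    simp only [mem_preimage, mem_prod, mem_singleton_iff, funext_iff, mem_ofPred_eq,
      Preorder.frestrictLe_apply, Subtype.forall, Finset.mem_Iic]
    constructor
    · rintro ⟨h, h'⟩ i hi
      rcases Nat.le_succ_iff.1 hi with hi | rfl
      · exact h i hi
      · exact h'
    · exact fun h ↦ ⟨fun i hi ↦ h i (by omega), h _ le_rfl⟩
  rw [e1, e2] at h1
  rw [quenchedLaw, ← h1, mul_comm]
  rfl

theorem measurable_quenchedLaw_cylinder (n : ℕ) (x : ℕ → ℤ) :
    Measurable fun ω ↦ quenchedLaw ω {X | ∀ i ≤ n, X i = x i} := by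
  induction n with
  | zero => simp only [quenchedLaw_zero]; exact measurable_const
  | succ n ih =>
    simp only [quenchedLaw_succ]
    exact ih.mul (measurable_stepLaw _ _)

/-- The quenched law depends measurably on the environment. -/
theorem measurable_quenchedLaw : Measurable quenchedLaw := by
  refine Measurable.measure_of_isPiSystem_of_isProbabilityMeasure
    (S := measurableCylinders fun _ : ℕ ↦ ℤ) generateFrom_measurableCylinders.symm
    isPiSystem_measurableCylinders fun t ht ↦ ?_
  obtain ⟨N, A, -, rfl⟩ : ∃ N A, MeasurableSet A ∧ t = cylinder (Finset.Iic N) A := by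
    simpa [measurableCylinders_nat] using ht
  have key : ∀ ω, quenchedLaw ω (cylinder (Finset.Iic N) A)
      = ∑' h : A, quenchedLaw ω
        {X | ∀ i ≤ N, X i = if hi : i ∈ Finset.Iic N then h.1 ⟨i, hi⟩ else 0} := by
    intro ω
    have e : ∀ h : A, {X : ℕ → ℤ | ∀ i ≤ N, X i =
        if hi : i ∈ Finset.Iic N then h.1 ⟨i, hi⟩ else 0}
        = (Finset.Iic N).restrict (π := fun _ ↦ ℤ) ⁻¹' {h.1} := by
      intro h
      ext X
      simp only [mem_ofPred_eq, mem_preimage, mem_singleton_iff, funext_iff, Subtype.forall,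
        Finset.mem_Iic, Finset.restrict]
      exact forall₂_congr fun i hi ↦ by rw [dif_pos hi]
    simp only [e]
    rw [← measure_iUnion]
    · congr 1
      ext X
      simp [cylinder]
    · intro h h' hh
      refine Disjoint.preimage _ ?_
      simpa [Subtype.ext_iff] using fun h0 ↦ hh (Subtype.ext h0)
    · exact fun h ↦ (Finset.measurable_restrict _) (MeasurableSet.singleton _)
  simp only [key]
  exact Measurable.tsum fun h ↦ measurable_quenchedLaw_cylinder _ _

/-- The quenched law as a kernel from environments to paths. -/
def quenchedKernel : Kernel Env (ℕ → ℤ) := ⟨quenchedLaw, measurable_quenchedLaw⟩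

/-- The law of the i.i.d. environment with marginal `ν`. -/
def envLaw (ν : Measure (Ioo (0 : ℝ) 1)) : Measure Env := Measure.infinitePi fun _ : ℤ ↦ ν

/-- The annealed law `𝐏(·) = ∫ P_ω(·) dℙ(ω)` of the walk. -/
def annealedLaw (ν : Measure (Ioo (0 : ℝ) 1)) : Measure (ℕ → ℤ) :=
  (envLaw ν).bind quenchedKernel

/-- The hitting time `T_n = inf {t : X t = n}` (infinite if `n` is never hit). -/
def hittingTime (X : ℕ → ℤ) (n : ℕ) : ℕ∞ := ⨅ (t : ℕ) (_ : X t = n), (t : ℕ∞)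

/-- `L_x^n`, the number of steps from `x` to `x - 1` before time `T_n`. -/
def leftSteps (X : ℕ → ℤ) (n x : ℕ) : ℕ :=
  {t : ℕ | (t : ℕ∞) < hittingTime X n ∧ X t = x ∧ X (t + 1) = (x : ℤ) - 1}.ncard

/-- `∫ a^(u+1) (1-a)^v dν(a)`. -/
def mixedMoment (ν : Measure (Ioo (0 : ℝ) 1)) (u v : ℕ) : ℝ :=
  ∫ a, (a : ℝ) ^ (u + 1) * (1 - (a : ℝ)) ^ v ∂ν

/-- `φ(u,v) = log ∫ a^(u+1) (1-a)^v dν(a)`. -/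
def phi (ν : Measure (Ioo (0 : ℝ) 1)) (u v : ℕ) : ℝ := Real.log (mixedMoment ν u v)

/-- The transition kernel `Q(u,v) = C(u+v,v) ∫ a^(u+1) (1-a)^v dν(a)` on `ℕ`. -/
def Q (ν : Measure (Ioo (0 : ℝ) 1)) (u v : ℕ) : ℝ := ((u + v).choose v : ℝ) * mixedMoment ν u v

/-- `ρ_x = (1 - ω x) / ω x`. -/
def rho (ω : Env) (x : ℤ) : ℝ := (1 - (ω x : ℝ)) / (ω x : ℝ)

/-- `S = (∑_{k ≥ 0} ρ_1 ⋯ ρ_k)⁻¹`. -/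
def S (ω : Env) : ℝ := (∑' k : ℕ, ∏ i ∈ Finset.Icc 1 k, rho ω (i : ℤ))⁻¹

/-- The invariant probability of `Q`: `π(u) = 𝔼[S (1 - S)^u]`. -/
def piInv (ν : Measure (Ioo (0 : ℝ) 1)) (u : ℕ) : ℝ := ∫ ω, S ω * (1 - S ω) ^ u ∂(envLaw ν)

/-- `π̃(u,v) = π(u) Q(u,v)`. -/
def piTilde (ν : Measure (Ioo (0 : ℝ) 1)) (u v : ℕ) : ℝ := piInv ν u * Q ν u v

/-- The expectation `π̃(g) = ∑_{u,v} π̃(u,v) g(u,v)` of a nonnegative function `g`, with values in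
`[0,∞]`. -/
def expPiTilde (ν : Measure (Ioo (0 : ℝ) 1)) (g : ℕ → ℕ → ℝ≥0∞) : ℝ≥0∞ :=
  ∑' u : ℕ, ∑' v : ℕ, ENNReal.ofReal (piTilde ν u v) * g u v

/-- The criterion `ℓ_n(θ) = ∑_{x<n} [φ_θ(L_{x+1}^n, L_x^n) - φ_{θ₀}(L_{x+1}^n, L_x^n)]`. -/
def criterion (ν : ℝ → Measure (Ioo (0 : ℝ) 1)) (θ₀ : ℝ) (n : ℕ) (X : ℕ → ℤ) (θ : ℝ) : ℝ :=
  ∑ x ∈ Finset.range n,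
    (phi (ν θ) (leftSteps X n (x + 1)) (leftSteps X n x)
      - phi (ν θ₀) (leftSteps X n (x + 1)) (leftSteps X n x))

/-- `n⁻¹ ∑_{x<n} sup_{θ ∈ A} [φ_θ(L_{x+1}^n, L_x^n) - φ_{θ₀}(L_{x+1}^n, L_x^n)]`, in the extended
reals, where the supremum over the empty set is `-∞`. -/
def supCriterion (ν : ℝ → Measure (Ioo (0 : ℝ) 1)) (θ₀ : ℝ) (A : Set ℝ) (n : ℕ) (X : ℕ → ℤ) :
    EReal :=
  (((n : ℝ)⁻¹ : ℝ) : EReal) * ∑ x ∈ Finset.range n, ⨆ θ ∈ A,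
    ((phi (ν θ) (leftSteps X n (x + 1)) (leftSteps X n x)
      - phi (ν θ₀) (leftSteps X n (x + 1)) (leftSteps X n x) : ℝ) : EReal)

/-- The uniform integrability condition at the reference parameter `θ₀`: for every `θ ∈ Θ`,
`π̃_θ(sup_{θ' ∈ Θ} |φ_θ' - φ_θ₀|) < ∞`. -/
def UniformlyIntegrableCriterion (ν : ℝ → Measure (Ioo (0 : ℝ) 1)) (Θ : Set ℝ) (θ₀ : ℝ) : Prop :=
  ∀ θ ∈ Θ, expPiTilde (ν θ)
    (fun u v ↦ ⨆ θ' ∈ Θ, ENNReal.ofReal |phi (ν θ') u v - phi (ν θ₀) u v|) < ⊤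

/-- The derivative `φ'_θ(u,v)` of `θ ↦ φ_θ(u,v)`. -/
def phiDeriv (ν : ℝ → Measure (Ioo (0 : ℝ) 1)) (θ : ℝ) (u v : ℕ) : ℝ :=
  deriv (fun b ↦ phi (ν b) u v) θ

/-- The Fisher information `Σ_θ = π̃_θ((φ'_θ)²) ∈ [0,∞]`. -/
def fisherInformation (ν : ℝ → Measure (Ioo (0 : ℝ) 1)) (θ : ℝ) : ℝ≥0∞ :=
  expPiTilde (ν θ) fun u v ↦ ENNReal.ofReal (phiDeriv ν θ u v ^ 2)

/-- The Temkin model: `ν_a = p δ_a + (1 - p) δ_{1 - a}`, as a measure on `(0,1)`. -/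
def temkin (p a : ℝ) : Measure (Ioo (0 : ℝ) 1) :=
  (ENNReal.ofReal p • Measure.dirac a + ENNReal.ofReal (1 - p) • Measure.dirac (1 - a)).comap
    Subtype.val

/-- The Kullback–Leibler distance between Bernoulli laws,
`d(q|q') = q log (q/q') + (1-q) log ((1-q)/(1-q'))`. -/
def dKL (q q' : ℝ) : ℝ := q * Real.log (q / q') + (1 - q) * Real.log ((1 - q) / (1 - q'))

end RWRE

end

noncomputable section

namespace RWRE

open MeasureTheory ProbabilityTheory Set Filter

open scoped ENNReal Topology

/-! Write ρ for (1-ω)/ω at a site. Given u = L_{x+1} and the environment, the number v = L_x of left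
steps from x is negative binomial with mean ρ(u+1). Averaging over the i.i.d. environment, the
numbers L_n = 0, L_{n-1}, …, L_0 form a Markov chain with kernel Q (`annealedLaw_leftSteps_mem_le`;
upper bounds on its law suffice). Two features of the model drive everything. Since p < 1/2 and a <
1/2, log ρ has negative mean: the walk is transient to the right, T_n is finite, and S > 0 almost
surely. Since a < p, ρ itself has mean at least 1: the walk has zero speed and the invariant law π
has infinite mean, because Σ (u+1) S(1-S)^u = 1/S = Σ_k ρ_1⋯ρ_k has expectation Σ_k (E ρ)^k
(`tsum_piInv_mul_succ`).

Part (a). A site of either type reveals a through v/(u+1), so the log-likelihood ratio of θ against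
the true b is at most a constant, minus d_KL(b|θ)(u+1), plus a multiple of |v - ρ(u+1)|
(`phi_sub_phi_le_dKL`). Half of the drift absorbs the fluctuation, leaving a normalized squared
deviation whose conditional mean is bounded uniformly in u (`exists_phi_sub_phi_le`,
`tsum_Q_mul_deviation_le`). Meanwhile Σ L_x exceeds any multiple of n with high probability
(`tendsto_annealedLaw_sum_leftSteps_le`): the mean of m consecutive values of the chain is at least
m(m-1)/2, and stochastic monotonicity makes its Laplace transform submultiplicative, so a Chernoff
bound applies. Hence the normalized criterion tends to -∞, uniformly away from b. Consistency
follows because a maximizer does at least as well as b.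

Parts (b) and (c). With probability p a site is of the unfavourable type ω = a, where v is close to
(1-a)/a·(u+1) and the score is, up to a controlled error, linear in (u,v)
(`exists_abs_phiDeriv_sub_le`). The conditional means given u of the squared score at the true
parameter, of the absolute score at a wrong one, and of the log-likelihood ratio all grow linearly
in u. Integrating against π, which has infinite mean, gives infinity (`expPiTilde_eq_top`). -/

theorem hasSum_of_eq {f g : ℕ → ℝ} {a b : ℝ} (h : HasSum f a) (hf : ∀ i, g i = f i) (hb : b = a) :
    HasSum g b := by
  rw [hb, funext hf]; exact h

/-! ### Negative binomial laws: moments and stochastic monotonicity -/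

/-- The negative binomial mass function: `v` failures before the `(u+1)`-st success. -/
def nbMass (w : ℝ) (u v : ℕ) : ℝ := ((u + v).choose v : ℝ) * (w ^ (u + 1) * (1 - w) ^ v)

theorem nbMass_nonneg {w : ℝ} (h0 : 0 < w) (h1 : w < 1) (u v : ℕ) : 0 ≤ nbMass w u v := by
  have : 0 ≤ 1 - w := by linarith
  unfold nbMass; positivity

theorem hasSum_pow_mul_nbMass {w s : ℝ} (h1 : w < 1) (hs : 0 ≤ s)
    (hs' : (1 - w) * s < 1) (u : ℕ) :
    HasSum (fun v ↦ nbMass w u v * s ^ v) ((w / (1 - (1 - w) * s)) ^ (u + 1)) := by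
  have hn : ‖(1 - w) * s‖ < 1 := by
    rw [Real.norm_of_nonneg (mul_nonneg (by linarith) hs)]; exact hs'
  have h := (hasSum_choose_mul_geometric_of_norm_lt_one u hn).mul_left (w ^ (u + 1))
  refine hasSum_of_eq h (fun v ↦ ?_) ?_
  · rw [nbMass, mul_pow, add_comm v u, Nat.choose_symm_add]
    ring
  · rw [div_pow]; ring

theorem hasSum_nbMass {w : ℝ} (h0 : 0 < w) (h1 : w < 1) (u : ℕ) :
    HasSum (fun v ↦ nbMass w u v) 1 := by
  have h := hasSum_pow_mul_nbMass h1 zero_le_one (by linarith) u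
  simpa [h0.ne'] using h

/-- Size-biasing identity: a factor v trades one failure for one more success. Iterating it yields
the first two moments from the total mass alone. -/
theorem succ_mul_nbMass_succ {w : ℝ} (h0 : 0 < w) (u v : ℕ) :
    ((v : ℝ) + 1) * nbMass w u (v + 1) = (u + 1) * ((1 - w) / w) * nbMass w (u + 1) v := by
  have h : (v + 1) * (u + (v + 1)).choose (v + 1) = (u + 1) * (u + 1 + v).choose v := by
    have h1 := Nat.add_one_mul_choose_eq (u + v) v
    have h2 := Nat.add_one_mul_choose_eq (u + v) u
    rw [show u + (v + 1) = u + v + 1 by ring, show u + 1 + v = u + v + 1 by ring]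
    have e : (u + v + 1).choose v = (u + v + 1).choose (u + 1) := by
      rw [← Nat.choose_symm_of_eq_add]; omega
    rw [e, mul_comm, ← h1, mul_comm (u + 1), ← h2, Nat.choose_symm_add]
  have h' : ((v : ℝ) + 1) * (u + (v + 1)).choose (v + 1) = (u + 1) * (u + 1 + v).choose v := by
    exact_mod_cast h
  unfold nbMass
  rw [← mul_assoc, h', pow_succ w (u + 1), pow_succ (1 - w) v]
  field_simp

theorem hasSum_mul_nbMass {w : ℝ} (h0 : 0 < w) {u : ℕ} {g : ℕ → ℝ} {s : ℝ}
    (h : HasSum (fun v ↦ nbMass w (u + 1) v * g (v + 1)) s) :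
    HasSum (fun v : ℕ ↦ nbMass w u v * (v * g v)) ((u + 1) * ((1 - w) / w) * s) := by
  rw [← hasSum_nat_add_iff' 1]
  refine hasSum_of_eq (h.mul_left ((u + 1) * ((1 - w) / w))) (fun v ↦ ?_) ?_
  · have := succ_mul_nbMass_succ h0 u v
    push_cast
    linear_combination (g (v + 1)) * this
  · simp

theorem hasSum_nbMass_mean {w : ℝ} (h0 : 0 < w) (h1 : w < 1) (u : ℕ) :
    HasSum (fun v : ℕ ↦ nbMass w u v * v) ((u + 1) * ((1 - w) / w)) := by
  have := hasSum_mul_nbMass (u := u) (g := fun _ ↦ 1) h0 (by simpa using hasSum_nbMass h0 h1 (u + 1))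
  simpa using this

theorem hasSum_nbMass_sq {w : ℝ} (h0 : 0 < w) (h1 : w < 1) (u : ℕ) :
    HasSum (fun v : ℕ ↦ nbMass w u v * (v : ℝ) ^ 2)
      ((u + 1) * ((1 - w) / w) * ((u + 2) * ((1 - w) / w) + 1)) := by
  have h := (hasSum_nbMass_mean h0 h1 (u + 1)).add (hasSum_nbMass h0 h1 (u + 1))
  have := hasSum_mul_nbMass (u := u) (g := fun v ↦ (v : ℝ)) h0 (s := ((u + 2) * ((1 - w) / w) + 1))
    (hasSum_of_eq h (fun v ↦ by push_cast; ring) (by push_cast; ring))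
  exact hasSum_of_eq this (fun v ↦ by ring) rfl

theorem hasSum_nbMass_quadratic {w : ℝ} (h0 : 0 < w) (h1 : w < 1) (u : ℕ) (b0 b1 b2 : ℝ) :
    HasSum (fun v : ℕ ↦ nbMass w u v * (b0 + b1 * v + b2 * (v : ℝ) ^ 2))
      (b0 + b1 * ((u + 1) * ((1 - w) / w))
        + b2 * ((u + 1) * ((1 - w) / w) * ((u + 2) * ((1 - w) / w) + 1))) := by
  have := (((hasSum_nbMass h0 h1 u).mul_left b0).add ((hasSum_nbMass_mean h0 h1 u).mul_left b1)).add
    ((hasSum_nbMass_sq h0 h1 u).mul_left b2)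
  exact hasSum_of_eq this (fun v ↦ by ring) (by ring)

theorem hasSum_nbMass_variance {w : ℝ} (h0 : 0 < w) (h1 : w < 1) (u : ℕ) :
    HasSum (fun v : ℕ ↦ nbMass w u v * ((v : ℝ) - (1 - w) / w * (u + 1)) ^ 2)
      (((1 - w) / w + ((1 - w) / w) ^ 2) * (u + 1)) := by
  have := hasSum_nbMass_quadratic h0 h1 u (((1 - w) / w * (u + 1)) ^ 2)
    (-2 * ((1 - w) / w * (u + 1))) 1
  exact hasSum_of_eq this (fun v ↦ by ring) (by ring)

theorem summable_nbMass_mul {w : ℝ} (h0 : 0 < w) (h1 : w < 1) (u : ℕ) {g : ℕ → ℝ}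
    (hg : ∀ v, g v ∈ Icc (0 : ℝ) 1) : Summable fun v ↦ nbMass w u v * g v :=
  (hasSum_nbMass h0 h1 u).summable.of_nonneg_of_le
    (fun v ↦ mul_nonneg (nbMass_nonneg h0 h1 u v) (hg v).1)
    (fun v ↦ mul_le_of_le_one_right (nbMass_nonneg h0 h1 u v) (hg v).2)

theorem nbMass_succ_succ (w : ℝ) (u v : ℕ) :
    nbMass w (u + 1) (v + 1) = (1 - w) * nbMass w (u + 1) v + w * nbMass w u (v + 1) := by
  have h : (u + 1 + (v + 1)).choose (v + 1)
      = (u + 1 + v).choose v + (u + (v + 1)).choose (v + 1) := by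
    rw [show u + 1 + (v + 1) = (u + 1 + v) + 1 by ring, Nat.choose_succ_succ]
    congr 2; ring
  unfold nbMass
  rw [h]; push_cast; ring

/-- The negative binomial laws are stochastically increasing in the number of successes. -/
theorem antitone_tsum_nbMass {w : ℝ} (h0 : 0 < w) (h1 : w < 1) {g : ℕ → ℝ}
    (hg : ∀ v, g v ∈ Icc (0 : ℝ) 1) (hga : Antitone g) :
    Antitone fun u ↦ ∑' v, nbMass w u v * g v := by
  refine antitone_nat_of_succ_le fun u ↦ ?_
  have s1 := summable_nbMass_mul h0 h1 (u + 1) hg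
  have s0 := summable_nbMass_mul h0 h1 u hg
  have s2 : Summable fun v ↦ nbMass w (u + 1) v * g (v + 1) :=
    summable_nbMass_mul h0 h1 (u + 1) fun v ↦ hg (v + 1)
  have e1 := s1.tsum_eq_zero_add
  have e0 := s0.tsum_eq_zero_add
  -- Conditioning on the first trial: a failure shifts `g` by one, a success lowers `u + 1` to `u`.
  -- As `g` is antitone, the shifted term is at most the unshifted one, and solving for it gives the
  -- comparison.
  have key : ∑' v, nbMass w (u + 1) (v + 1) * g (v + 1)
      = (1 - w) * ∑' v, nbMass w (u + 1) v * g (v + 1)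
        + w * ∑' v, nbMass w u (v + 1) * g (v + 1) := by
    rw [← tsum_mul_left, ← tsum_mul_left, ← (s2.mul_left _).tsum_add
      (((summable_nat_add_iff 1).2 s0).mul_left _)]
    refine tsum_congr fun v ↦ ?_
    rw [nbMass_succ_succ]; ring
  have hle : ∑' v, nbMass w (u + 1) v * g (v + 1) ≤ ∑' v, nbMass w (u + 1) v * g v :=
    s2.tsum_le_tsum (fun v ↦ mul_le_mul_of_nonneg_left (hga (Nat.le_succ v))
      (nbMass_nonneg h0 h1 _ _)) s1
  have hz : nbMass w (u + 1) 0 = w * nbMass w u 0 := by simp [nbMass]; ring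
  have hfin : w * ∑' v, nbMass w (u + 1) v * g v ≤ w * ∑' v, nbMass w u v * g v := by
    have := mul_le_mul_of_nonneg_left hle (by linarith : 0 ≤ 1 - w)
    rw [hz] at e1
    nlinarith
  exact le_of_mul_le_mul_left hfin h0

/-! ### The two-point environment law and its mixed moments -/

theorem comap_dirac_coe (x : Ioo (0 : ℝ) 1) :
    (Measure.dirac (x : ℝ)).comap ((↑) : Ioo (0 : ℝ) 1 → ℝ) = Measure.dirac x := by
  ext s hs
  have he : MeasurableEmbedding ((↑) : Ioo (0 : ℝ) 1 → ℝ) :=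
    MeasurableEmbedding.subtype_coe measurableSet_Ioo
  rw [he.comap_apply, Measure.dirac_apply' _ (he.measurableSet_image.2 hs),
    Measure.dirac_apply' _ hs]
  by_cases hx : x ∈ s
  · rw [indicator_of_mem hx, indicator_of_mem (mem_image_of_mem _ hx)]; rfl
  · rw [indicator_of_notMem hx, indicator_of_notMem (fun h ↦ hx (Subtype.val_injective.mem_set_image.1 h))]

/-- The point `1 - a` of `(0,1)`. -/
def reflect (a : Ioo (0 : ℝ) 1) : Ioo (0 : ℝ) 1 :=
  ⟨1 - a, by linarith [a.2.2], by linarith [a.2.1]⟩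

theorem temkin_eq (p : ℝ) (a : Ioo (0 : ℝ) 1) :
    temkin p a = ENNReal.ofReal p • Measure.dirac a
      + ENNReal.ofReal (1 - p) • Measure.dirac (reflect a) := by
  have he : MeasurableEmbedding ((↑) : Ioo (0 : ℝ) 1 → ℝ) :=
    MeasurableEmbedding.subtype_coe measurableSet_Ioo
  rw [temkin, ← comap_dirac_coe a, ← comap_dirac_coe (reflect a)]
  ext s hs
  simp [he.comap_apply, reflect]

theorem isProbabilityMeasure_temkin {p a : ℝ} (h0 : 0 ≤ p) (h1 : p ≤ 1) (ha : a ∈ Ioo (0 : ℝ) 1) :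
    IsProbabilityMeasure (temkin p a) := by
  lift a to Ioo (0 : ℝ) 1 using ha
  refine ⟨?_⟩
  rw [temkin_eq]
  simp only [Measure.add_apply, Measure.smul_apply, smul_eq_mul, measure_univ, mul_one]
  rw [← ENNReal.ofReal_add h0 (by linarith)]
  simp

theorem lintegral_temkin {p a : ℝ} (ha : a ∈ Ioo (0 : ℝ) 1) {f : Ioo (0 : ℝ) 1 → ℝ≥0∞} :
    ∫⁻ x, f x ∂(temkin p a) = ENNReal.ofReal p * f ⟨a, ha⟩
      + ENNReal.ofReal (1 - p) * f (reflect ⟨a, ha⟩) := by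
  have := temkin_eq p ⟨a, ha⟩
  simp only at this
  rw [this]
  simp

theorem integral_temkin {p a : ℝ} (h0 : 0 ≤ p) (h1 : p ≤ 1) (ha : a ∈ Ioo (0 : ℝ) 1)
    {f : Ioo (0 : ℝ) 1 → ℝ} :
    ∫ x, f x ∂(temkin p a) = p * f ⟨a, ha⟩ + (1 - p) * f (reflect ⟨a, ha⟩) := by
  have := temkin_eq p ⟨a, ha⟩
  simp only at this
  rw [this, integral_add_measure, integral_smul_measure, integral_smul_measure]
  · simp [h0, h1]
  · exact (integrable_dirac (by simp)).smul_measure (by simp)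
  · exact (integrable_dirac (by simp)).smul_measure (by simp)

theorem mixedMoment_temkin {p a : ℝ} (h0 : 0 ≤ p) (h1 : p ≤ 1) (ha : a ∈ Ioo (0 : ℝ) 1)
    (u v : ℕ) : mixedMoment (temkin p a) u v
      = p * (a ^ (u + 1) * (1 - a) ^ v) + (1 - p) * ((1 - a) ^ (u + 1) * a ^ v) := by
  rw [mixedMoment, integral_temkin h0 h1 ha]
  simp [reflect]

theorem Q_temkin {p a : ℝ} (h0 : 0 ≤ p) (h1 : p ≤ 1) (ha : a ∈ Ioo (0 : ℝ) 1)
    (u v : ℕ) : Q (temkin p a) u v = p * nbMass a u v + (1 - p) * nbMass (1 - a) u v := by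
  rw [Q, mixedMoment_temkin h0 h1 ha, nbMass, nbMass]
  ring_nf

/-! ### Kullback-Leibler bound on the log-likelihood ratio -/

theorem dKL_nonneg_and_pos {a b : ℝ} (ha : a ∈ Ioo (0 : ℝ) 1) (hb : b ∈ Ioo (0 : ℝ) 1) :
    0 ≤ dKL a b ∧ (a ≠ b → 0 < dKL a b) := by
  obtain ⟨ha0, ha1⟩ := ha
  obtain ⟨hb0, hb1⟩ := hb
  have e1 : a * Real.log (a / b) = - (a * Real.log (b / a)) := by
    rw [← inv_div b a, Real.log_inv]; ring
  have e2 : (1 - a) * Real.log ((1 - a) / (1 - b)) = - ((1 - a) * Real.log ((1 - b) / (1 - a))) := by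
    rw [← inv_div (1 - b) (1 - a), Real.log_inv]; ring
  have hpos1 : 0 < b / a := by positivity
  have hpos2 : 0 < (1 - b) / (1 - a) := div_pos (by linarith) (by linarith)
  have l1 := mul_le_mul_of_nonneg_left (Real.log_le_sub_one_of_pos hpos1) ha0.le
  have l2 := mul_le_mul_of_nonneg_left (Real.log_le_sub_one_of_pos hpos2)
    (by linarith : 0 ≤ 1 - a)
  have m1 : a * (b / a - 1) = b - a := by field_simp
  have m2 : (1 - a) * ((1 - b) / (1 - a) - 1) = a - b := by
    have : 1 - a ≠ 0 := by linarith
    field_simp; ring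
  refine ⟨by rw [dKL, e1, e2]; linarith, fun hab ↦ ?_⟩
  have l1' := mul_lt_mul_of_pos_left (Real.log_lt_sub_one_of_pos hpos1
    (by rw [ne_eq, div_eq_one_iff_eq ha0.ne']; exact fun h ↦ hab h.symm)) ha0
  rw [dKL, e1, e2]; linarith

theorem mixedMoment_temkin_pos {p a : ℝ} (h0 : 0 < p) (h1 : p < 1) (ha : a ∈ Ioo (0 : ℝ) 1)
    (u v : ℕ) : 0 < mixedMoment (temkin p a) u v := by
  rw [mixedMoment_temkin h0.le h1.le ha]
  have h2 : 0 < 1 - p := by linarith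
  have h3 : 0 < 1 - a := by linarith [ha.2]
  have h4 := ha.1
  positivity

theorem pow_mul_pow_le {a : ℝ} (h0 : 0 < a) (h1 : a < 1 / 2) {m n : ℕ} (h : m ≤ n) :
    (1 - a) ^ m * a ^ n ≤ a ^ m * (1 - a) ^ n := by
  obtain ⟨d, rfl⟩ := Nat.exists_eq_add_of_le h
  have h3 : 0 < 1 - a := by linarith
  have : a ^ d ≤ (1 - a) ^ d := pow_le_pow_left₀ h0.le (by linarith) d
  calc (1 - a) ^ m * a ^ (m + d) = (a ^ m * (1 - a) ^ m) * a ^ d := by ring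
    _ ≤ (a ^ m * (1 - a) ^ m) * (1 - a) ^ d := by gcongr
    _ = _ := by ring

/-- As a < 1/2, the larger of the two monomials gives the larger exponent to 1 - a. The mixture is
at most this monomial and at least p times it, since p ≤ 1 - p, so φ equals its logarithm up to log
(1/p). -/
theorem mixedMoment_temkin_le {p a : ℝ} (h0 : 0 < p) (h1 : p < 1 / 2) (ha0 : 0 < a)
    (ha1 : a < 1 / 2) (u v : ℕ) :
    mixedMoment (temkin p a) u v ≤ a ^ (min (u + 1) v) * (1 - a) ^ (max (u + 1) v) := by
  rw [mixedMoment_temkin h0.le (by linarith) ⟨ha0, by linarith⟩]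
  rcases le_total (u + 1) v with h | h
  · rw [min_eq_left h, max_eq_right h]
    nlinarith [pow_mul_pow_le ha0 ha1 h]
  · rw [min_eq_right h, max_eq_left h]
    nlinarith [pow_mul_pow_le ha0 ha1 h]

theorem le_mixedMoment_temkin {p a : ℝ} (h0 : 0 < p) (h1 : p < 1 / 2) (ha0 : 0 < a)
    (ha1 : a < 1 / 2) (u v : ℕ) :
    p * (a ^ (min (u + 1) v) * (1 - a) ^ (max (u + 1) v)) ≤ mixedMoment (temkin p a) u v := by
  rw [mixedMoment_temkin h0.le (by linarith) ⟨ha0, by linarith⟩]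
  have h3 : 0 < 1 - a := by linarith
  have hx : 0 < a ^ (u + 1) * (1 - a) ^ v := by positivity
  have hy : 0 < (1 - a) ^ (u + 1) * a ^ v := by positivity
  rcases le_total (u + 1) v with h | h
  · rw [min_eq_left h, max_eq_right h]
    nlinarith
  · rw [min_eq_right h, max_eq_left h]
    nlinarith

theorem phi_sub_phi_le {p a b : ℝ} (h0 : 0 < p) (h1 : p < 1 / 2) (ha0 : 0 < a)
    (ha1 : a < 1 / 2) (hb0 : 0 < b) (hb1 : b < 1 / 2) (u v : ℕ) :
    phi (temkin p a) u v - phi (temkin p b) u v ≤ Real.log (1 / p)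
      + min ((u : ℝ) + 1) v * Real.log (a / b)
      + max ((u : ℝ) + 1) v * Real.log ((1 - a) / (1 - b)) := by
  have ha : 0 < 1 - a := by linarith
  have hb : 0 < 1 - b := by linarith
  have u1 := Real.log_le_log (mixedMoment_temkin_pos h0 (by linarith) ⟨ha0, by linarith⟩ u v)
    (mixedMoment_temkin_le h0 h1 ha0 ha1 u v)
  have u2 := Real.log_le_log (by positivity) (le_mixedMoment_temkin h0 h1 hb0 hb1 u v)
  rw [Real.log_mul (by positivity) (by positivity), Real.log_pow, Real.log_pow] at u1
  rw [Real.log_mul (by positivity) (by positivity), Real.log_mul (by positivity) (by positivity),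
    Real.log_pow, Real.log_pow] at u2
  push_cast at u1 u2
  rw [phi, phi, Real.log_div ha0.ne' hb0.ne', Real.log_div ha.ne' hb.ne', one_div, Real.log_inv]
  linarith

/-- At the conditional mean v = (1-w)/w·(u+1) of either site type, the min/max expression is exactly
-d_KL(b|a)(u+1)/w. Dividing by w ≤ 1 only makes this more negative. Replacing the mean by the actual
v costs a multiple of the deviation, because min and max are 1-Lipschitz. -/
theorem phi_sub_phi_le_dKL {p a b w : ℝ} (h0 : 0 < p) (h1 : p < 1 / 2) (ha0 : 0 < a)
    (ha1 : a < 1 / 2) (hb0 : 0 < b) (hb1 : b < 1 / 2) (hw : w = b ∨ w = 1 - b) (u v : ℕ) :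
    phi (temkin p a) u v - phi (temkin p b) u v ≤ Real.log (1 / p)
      - dKL b a * (u + 1)
      + (|Real.log (a / b)| + |Real.log ((1 - a) / (1 - b))|)
        * |(v : ℝ) - (1 - w) / w * (u + 1)| := by
  refine (phi_sub_phi_le h0 h1 ha0 ha1 hb0 hb1 u v).trans ?_
  have ha : 0 < 1 - a := by linarith
  have hb : 0 < 1 - b := by linarith
  have hw0 : 0 < w := by rcases hw with rfl | rfl <;> assumption
  have hw1 : w ≤ 1 := by rcases hw with rfl | rfl <;> linarith
  have hkl := (dKL_nonneg_and_pos (a := b) (b := a) ⟨hb0, by linarith⟩ ⟨ha0, by linarith⟩).1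
  set U : ℝ := (u : ℝ) + 1 with hU
  have hUp : 0 < U := by positivity
  set V : ℝ := (1 - w) / w * U with hV
  set l := Real.log (a / b) with hl
  set k := Real.log ((1 - a) / (1 - b)) with hk
  have e : dKL b a = -(b * l + (1 - b) * k) := by
    rw [dKL, hl, hk, ← inv_div a b, ← inv_div (1 - a) (1 - b), Real.log_inv, Real.log_inv]; ring
  have main : min U V * l + max U V * k = -(dKL b a) / w * U := by
    rcases hw with h | h
    · have : U ≤ V := by
        rw [hV]; refine le_mul_of_one_le_left hUp.le ?_
        rw [one_le_div hw0]; linarith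
      rw [min_eq_left this, max_eq_right this, e, hV, h]
      field_simp
    · have : V ≤ U := by
        rw [hV]; refine mul_le_of_le_one_left hUp.le ?_
        rw [div_le_one hw0]; linarith
      rw [min_eq_right this, max_eq_left this, e, hV, h]
      field_simp
      ring
  have hq : -(dKL b a) / w * U ≤ - dKL b a * U := by
    refine mul_le_mul_of_nonneg_right ?_ hUp.le
    rw [div_le_iff₀ hw0]
    nlinarith
  have d1 : |min U (v : ℝ) - min U V| ≤ |(v : ℝ) - V| := by
    have := abs_min_sub_min_le_max U (v : ℝ) U V
    simpa using this
  have d2 : |max U (v : ℝ) - max U V| ≤ |(v : ℝ) - V| := by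
    have := abs_max_sub_max_le_max U (v : ℝ) U V
    simpa using this
  have q1 : (min U (v : ℝ) - min U V) * l ≤ |l| * |(v : ℝ) - V| := by
    refine (le_abs_self _).trans ?_
    rw [abs_mul, mul_comm]; gcongr
  have q2 : (max U (v : ℝ) - max U V) * k ≤ |k| * |(v : ℝ) - V| := by
    refine (le_abs_self _).trans ?_
    rw [abs_mul, mul_comm]; gcongr
  nlinarith

/-! ### The score -/

theorem hasDerivAt_pow_mul_pow {a : ℝ} (ha0 : a ≠ 0) (ha1 : 1 - a ≠ 0) (m n : ℕ) :
    HasDerivAt (fun b : ℝ ↦ b ^ m * (1 - b) ^ n)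
      (a ^ m * (1 - a) ^ n * (m / a - n / (1 - a))) a := by
  have h := (hasDerivAt_pow m a).mul (((hasDerivAt_id a).const_sub 1).pow n)
  refine h.congr_deriv ?_
  have e1 : (m : ℝ) * a ^ (m - 1) = a ^ m * (m / a) := by
    cases m with
    | zero => simp
    | succ m => simp; field_simp; ring
  have e2 : (n : ℝ) * (1 - a) ^ (n - 1) = (1 - a) ^ n * (n / (1 - a)) := by
    cases n with
    | zero => simp
    | succ n => simp; field_simp; ring
  simp only [id_eq, e1, e2, Pi.pow_apply]
  ring

theorem phiDeriv_temkin {p a : ℝ} (h0 : 0 < p) (h1 : p < 1) (ha : a ∈ Ioo (0 : ℝ) 1) (u v : ℕ) :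
    phiDeriv (temkin p) a u v
      = (p * (a ^ (u + 1) * (1 - a) ^ v * ((u + 1) / a - v / (1 - a)))
          + (1 - p) * (a ^ v * (1 - a) ^ (u + 1) * (v / a - (u + 1) / (1 - a))))
        / (p * (a ^ (u + 1) * (1 - a) ^ v) + (1 - p) * ((1 - a) ^ (u + 1) * a ^ v)) := by
  have hev : (fun b ↦ phi (temkin p b) u v) =ᶠ[𝓝 a] fun b ↦
      Real.log (p * (b ^ (u + 1) * (1 - b) ^ v) + (1 - p) * (b ^ v * (1 - b) ^ (u + 1))) := by
    filter_upwards [isOpen_Ioo.mem_nhds ha] with b hb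
    rw [phi, mixedMoment_temkin h0.le h1.le hb, mul_comm ((1 - b) ^ (u + 1))]
  have hpos := mixedMoment_temkin_pos h0 h1 ha u v
  rw [mixedMoment_temkin h0.le h1.le ha, mul_comm ((1 - a) ^ (u + 1))] at hpos
  have ha0 : a ≠ 0 := ha.1.ne'
  have ha1 : 1 - a ≠ 0 := by linarith [ha.2]
  rw [phiDeriv, hev.deriv_eq]
  have h := (((hasDerivAt_pow_mul_pow ha0 ha1 (u + 1) v).const_mul p).add
    ((hasDerivAt_pow_mul_pow ha0 ha1 v (u + 1)).const_mul (1 - p))).log hpos.ne'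
  rw [mul_comm ((1 - a) ^ (u + 1)) (a ^ v)]
  have h' := h.deriv
  push_cast at h'
  exact h'

theorem nat_mul_pow_le {q : ℝ} (h0 : 0 ≤ q) (h1 : q < 1) (d : ℕ) : d * q ^ d ≤ 1 / (1 - q) := by
  have h2 : 0 < 1 - q := by linarith
  have h := geom_sum_mul q d
  have h3 : (d : ℝ) * q ^ d ≤ ∑ i ∈ Finset.range d, q ^ i := by
    have : ∑ i ∈ Finset.range d, q ^ d ≤ ∑ i ∈ Finset.range d, q ^ i :=
      Finset.sum_le_sum fun i hi ↦
        pow_le_pow_of_le_one h0 h1.le (Finset.mem_range.1 hi).le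
    simpa using this
  rw [le_div_iff₀ h2]
  have := pow_nonneg h0 d
  nlinarith

/-- Up to the event that the site looks like one of the favourable type, the score is that of
the unfavourable type. -/
theorem exists_abs_phiDeriv_sub_le {p a : ℝ} (h0 : 0 < p) (h1 : p < 1) (ha0 : 0 < a)
    (ha1 : a < 1 / 2) : ∃ C, 0 ≤ C ∧ ∀ u v : ℕ,
      |phiDeriv (temkin p) a u v - ((u + 1) / a - v / (1 - a))|
        ≤ C * (1 + max 0 (((u : ℝ) + 1) - v)) := by
  have ha : 0 < 1 - a := by linarith
  set c := 1 / a + 1 / (1 - a) with hc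
  have hcp : 0 < c := by positivity
  set q := a / (1 - a) with hq
  have hq0 : 0 ≤ q := by positivity
  have hq1 : q < 1 := by rw [hq, div_lt_one ha]; linarith
  have hqq : 0 < 1 - q := by linarith
  have h2 : 0 < 1 - p := by linarith
  refine ⟨c * (1 + (1 - p) / p * (1 / (1 - q))), by positivity, fun u v ↦ ?_⟩
  rw [phiDeriv_temkin h0 h1 ⟨ha0, by linarith⟩]
  set x := a ^ (u + 1) * (1 - a) ^ v with hx
  set y := (1 - a) ^ (u + 1) * a ^ v with hy
  have hx0 : 0 < x := by positivity
  have hy0 : 0 < y := by positivity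
  have hden : 0 < p * x + (1 - p) * y := by positivity
  -- The score is the posterior mean of the scores of the two types, so the error is the posterior
  -- weight of the favourable type times the difference of the two scores, (v - (u+1))·c.
  have e : (p * (x * ((u + 1) / a - v / (1 - a)))
      + (1 - p) * (a ^ v * (1 - a) ^ (u + 1) * (v / a - (u + 1) / (1 - a))))
      / (p * x + (1 - p) * y) - ((u + 1) / a - v / (1 - a))
      = (1 - p) * y / (p * x + (1 - p) * y) * ((v - (u + 1)) * c) := by
    have : a ^ v * (1 - a) ^ (u + 1) = y := mul_comm _ _
    rw [this, hc, div_sub' hden.ne', div_mul_eq_mul_div]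
    congr 1
    ring
  rw [e, abs_mul, abs_mul, abs_of_pos hcp, abs_of_pos (by positivity)]
  have K : 0 ≤ (1 - p) / p * (1 / (1 - q)) := by positivity
  rcases le_total (v : ℝ) ((u : ℝ) + 1) with h | h
  · have t : (1 - p) * y / (p * x + (1 - p) * y) ≤ 1 := by
      rw [div_le_one hden]; nlinarith
    rw [max_eq_right (by linarith), abs_of_nonpos (by linarith)]
    have z : 0 ≤ -((v : ℝ) - (u + 1)) := by linarith
    calc _ ≤ 1 * (-((v : ℝ) - (u + 1)) * c) := by gcongr
      _ = c * 1 * (0 + ((u + 1) - v)) := by ring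
      _ ≤ c * (1 + (1 - p) / p * (1 / (1 - q))) * (1 + ((u + 1) - v)) := by
        gcongr <;> linarith
  -- With an excess d of left steps the posterior odds of the favourable type are (1-p)/p·q^d. This
  -- geometric factor beats the linear factor d.
  · obtain ⟨d, rfl⟩ : ∃ d, v = u + 1 + d :=
      Nat.exists_eq_add_of_le (by exact_mod_cast h)
    have t : (1 - p) * y / (p * x + (1 - p) * y) ≤ (1 - p) / p * q ^ d := by
      calc _ ≤ (1 - p) * y / (p * x) := by gcongr; nlinarith
        _ = (1 - p) / p * (y / x) := by field_simp
        _ = _ := by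
          congr 1
          rw [hy, hx, hq, div_pow, pow_add, pow_add]
          field_simp
          ring
    rw [max_eq_left (by linarith), abs_of_nonneg (by linarith)]
    push_cast
    rw [add_sub_cancel_left]
    have := nat_mul_pow_le hq0 hq1 d
    calc _ ≤ (1 - p) / p * q ^ d * (d * c) := by gcongr
      _ = c * ((1 - p) / p * (d * q ^ d)) := by ring
      _ ≤ c * ((1 - p) / p * (1 / (1 - q))) := by gcongr
      _ ≤ _ := by nlinarith

/-! ### Markov property of the quenched walk -/

/-- The initial segments of a path form a countable discrete space, so dependence on finitely many
coordinates already forces measurability. -/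
theorem measurable_of_dependsOn_Iic {β : Type*} [MeasurableSpace β] {F : (ℕ → ℤ) → β} {N : ℕ}
    (hF : DependsOn F (Iic N)) : Measurable F := by
  let e : ((i : Finset.Iic N) → ℤ) → ℕ → ℤ := fun h i ↦
    if hi : i ∈ Finset.Iic N then h ⟨i, hi⟩ else 0
  have : F = (fun h ↦ F (e h)) ∘ Preorder.frestrictLe (π := fun _ ↦ ℤ) N := by
    ext X
    refine hF fun i hi ↦ ?_
    have hi' : i ≤ N := hi
    simp [e, hi']
  rw [this]
  exact Measurable.comp Measurable.of_discrete (by fun_prop)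

theorem lintegral_stepLaw (ω : Env) (x : ℤ) (f : ℤ → ℝ≥0∞) :
    ∫⁻ z, f z ∂(stepLaw ω x)
      = ENNReal.ofReal (ω x) * f (x + 1) + ENNReal.ofReal (1 - ω x) * f (x - 1) := by
  simp [stepLaw]

/-- The Markov property of the quenched law at time `N`. -/
theorem lintegral_quenchedLaw_succ (ω : Env) (N : ℕ) {F : (ℕ → ℤ) → ℝ≥0∞}
    (hF : DependsOn F (Iic (N + 1))) :
    ∫⁻ X, F X ∂(quenchedLaw ω)
      = ∫⁻ X, (ENNReal.ofReal (ω (X N)) * F (Function.update X (N + 1) (X N + 1))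
          + ENNReal.ofReal (1 - ω (X N)) * F (Function.update X (N + 1) (X N - 1)))
          ∂(quenchedLaw ω) := by
  let e : ((i : Finset.Iic N) → ℤ) → ℤ → ℕ → ℤ := fun h z i ↦
    if hi : i ∈ Finset.Iic N then h ⟨i, hi⟩ else z
  let G : ((i : Finset.Iic N) → ℤ) × ℤ → ℝ≥0∞ := fun q ↦ F (e q.1 q.2)
  have hG : Measurable G := Measurable.of_discrete
  have hup : ∀ (X : ℕ → ℤ) z, F (Function.update X (N + 1) z)
      = G (Preorder.frestrictLe (π := fun _ ↦ ℤ) N X, z) := by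
    intro X z
    refine hF fun i hi ↦ ?_
    have hi : i ≤ N + 1 := hi
    rcases Nat.le_succ_iff.1 hi with hi | rfl
    · simp [e, hi, Function.update_of_ne (show i ≠ N + 1 by omega)]
    · simp [e]
  have h := Kernel.map_frestrictLe_trajMeasure_compProd_eq_map_trajMeasure
    (X := fun _ ↦ ℤ) (μ₀ := Measure.dirac (0 : ℤ)) (κ := stepKernel ω) (a := N)
  have h0 : ∀ X, F X = G (Preorder.frestrictLe (π := fun _ ↦ ℤ) N X, X (N + 1)) := fun X ↦ by
    rw [← hup, Function.update_eq_self]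
  calc ∫⁻ X, F X ∂(quenchedLaw ω)
      = ∫⁻ q, G q ∂((quenchedLaw ω).map
          (fun X ↦ (Preorder.frestrictLe (π := fun _ ↦ ℤ) N X, X (N + 1)))) := by
        rw [lintegral_map hG (by fun_prop)]
        exact lintegral_congr h0
    _ = ∫⁻ h, ∫⁻ z, G (h, z) ∂(stepKernel ω N h)
          ∂((quenchedLaw ω).map (Preorder.frestrictLe (π := fun _ ↦ ℤ) N)) := by
        rw [quenchedLaw, ← h, Measure.lintegral_compProd hG]
    _ = _ := by
        rw [lintegral_map Measurable.of_discrete (by fun_prop)]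
        refine lintegral_congr fun X ↦ ?_
        rw [hup, hup, ← lintegral_stepLaw ω (X N) fun z ↦
          G (Preorder.frestrictLe (π := fun _ ↦ ℤ) N X, z)]
        rfl

theorem quenchedLaw_ae_zero (ω : Env) : ∀ᵐ X ∂(quenchedLaw ω), X 0 = 0 := by
  have h := quenchedLaw_zero ω fun _ ↦ 0
  simp only [nonpos_iff_eq_zero, forall_eq, Measure.dirac_apply_of_mem (mem_singleton (0 : ℤ))] at h
  have hm : MeasurableSet {X : ℕ → ℤ | X 0 = 0} :=
    measurableSet_eq_fun (measurable_pi_apply 0) measurable_const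
  exact (prob_compl_eq_zero_iff hm).2 h

theorem quenchedLaw_ae_step (ω : Env) :
    ∀ᵐ X ∂(quenchedLaw ω), ∀ t : ℕ, X (t + 1) = X t + 1 ∨ X (t + 1) = X t - 1 := by
  refine ae_all_iff.2 fun t ↦ ?_
  classical
  let F : (ℕ → ℤ) → ℝ≥0∞ := fun X ↦ if X (t + 1) = X t + 1 ∨ X (t + 1) = X t - 1 then 0 else 1
  have hF : DependsOn F (Iic (t + 1)) := fun X Y h ↦ by
    simp only [F, h t (by simp), h (t + 1) (by simp)]
  have h := lintegral_quenchedLaw_succ ω t hF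
  simp only [F, Function.update_self, Function.update_of_ne (show t ≠ t + 1 by omega)] at h
  simp only [true_or, or_true, if_true, mul_zero, add_zero, lintegral_const, zero_mul] at h
  have := (lintegral_eq_zero_iff (measurable_of_dependsOn_Iic hF)).1 h
  filter_upwards [this] with X hX
  by_contra hc
  simp [F, hc] at hX

/-! ### Reaching a level to the right -/

/-- The path stays strictly below `n` up to time `t`. -/
def StaysBelow (n : ℤ) (t : ℕ) (X : ℕ → ℤ) : Prop := ∀ s ≤ t, X s < n

theorem dependsOn_staysBelow (n : ℤ) (t : ℕ) : DependsOn (StaysBelow n t) (Iic t) := by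
  intro X Y h
  exact propext (forall₂_congr fun s hs ↦ by rw [h s hs])

theorem staysBelow_succ {n : ℤ} {t : ℕ} {X : ℕ → ℤ} :
    StaysBelow n (t + 1) X ↔ StaysBelow n t X ∧ X (t + 1) < n := by
  constructor
  · exact fun h ↦ ⟨fun s hs ↦ h s (by omega), h _ le_rfl⟩
  · rintro ⟨h, h'⟩ s hs
    rcases Nat.le_succ_iff.1 hs with hs | rfl
    exacts [h s hs, h']

theorem staysBelow_update {n : ℤ} {t : ℕ} {X : ℕ → ℤ} {z : ℤ} :
    StaysBelow n (t + 1) (Function.update X (t + 1) z) ↔ StaysBelow n t X ∧ z < n := by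
  rw [staysBelow_succ, Function.update_self,
    dependsOn_staysBelow n t fun s (hs : s ≤ t) ↦ Function.update_of_ne (by omega) z X]

open scoped Classical in
theorem dependsOn_ite_staysBelow (n : ℤ) (t : ℕ) (f : ℤ → ℝ≥0∞) (c : ℝ≥0∞) :
    DependsOn (fun X : ℕ → ℤ ↦ if StaysBelow n t X then f (X t) else c) (Iic t) := by
  intro X Y h
  simp only [dependsOn_staysBelow n t h, h t (mem_Iic.2 le_rfl)]

open scoped Classical in
/-- In an elliptic environment, a walk that stays below `n` for ever tends to `-∞`. -/
theorem ae_tendsto_atBot_of_staysBelow {ω : Env} {c : ℝ} (hc : 0 < c) (hω : ∀ x, c ≤ ω x) (n : ℤ) :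
    ∀ᵐ X ∂(quenchedLaw ω), (∀ t, X t < n) → Tendsto X atTop atBot := by
  -- With ω ≥ c this base gives ω·K ≥ 2: one step at least doubles K^(x-n) in mean, even if the left
  -- step is discarded. Stopped at `n`, where its value is 1, the process is bounded by 1. Its gain
  -- in mean at each step dominates `A t`, so the `A t` have summable means and K^(X t - n) tends to
  -- 0 on paths that stay below `n`.
  set K : ℝ := 2 / c with hK
  have hc1 : c < 1 := (hω 0).trans_lt (ω 0).2.2
  have hK1 : 1 < K := by rw [hK, lt_div_iff₀ hc]; linarith
  have hK0 : 0 < K := by linarith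
  let g : ℤ → ℝ≥0∞ := fun x ↦ ENNReal.ofReal (K ^ (x - n))
  have hg1 : ∀ x, x ≤ n → g x ≤ 1 := fun x hx ↦ by
    rw [← ENNReal.ofReal_one]
    exact ENNReal.ofReal_le_ofReal (zpow_le_one_of_nonpos₀ hK1.le (by omega))
  let A : ℕ → (ℕ → ℤ) → ℝ≥0∞ := fun t X ↦ if StaysBelow n t X then g (X t) else 0
  let G : ℕ → (ℕ → ℤ) → ℝ≥0∞ := fun t X ↦ if StaysBelow n t X then g (X t) else 1
  have hA : ∀ t, Measurable (A t) := fun t ↦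
    measurable_of_dependsOn_Iic (dependsOn_ite_staysBelow n t g 0)
  have hG : ∀ t, DependsOn (G t) (Iic t) := fun t ↦ dependsOn_ite_staysBelow n t g 1
  have hG1 : ∀ t, ∫⁻ X, G t X ∂(quenchedLaw ω) ≤ 1 := fun t ↦ by
    calc ∫⁻ X, G t X ∂(quenchedLaw ω) ≤ ∫⁻ _, 1 ∂(quenchedLaw ω) := by
          refine lintegral_mono fun X ↦ ?_
          simp only [G]
          split_ifs with h
          · exact hg1 _ (h t le_rfl).le
          · exact le_rfl
      _ = 1 := by simp
  have hstep : ∀ t, ∫⁻ X, A t X ∂(quenchedLaw ω) + ∫⁻ X, G t X ∂(quenchedLaw ω)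
      ≤ ∫⁻ X, G (t + 1) X ∂(quenchedLaw ω) := by
    intro t
    rw [← lintegral_add_left (hA t), lintegral_quenchedLaw_succ ω t (hG (t + 1))]
    refine lintegral_mono fun X ↦ ?_
    simp only [A, G, staysBelow_update, Function.update_self]
    by_cases h : StaysBelow n t X
    · have hX : X t < n := h t le_rfl
      simp only [h, true_and, if_true]
      refine le_trans ?_ le_self_add
      have e1 : (if X t + 1 < n then g (X t + 1) else 1) = g (X t + 1) := by
        split_ifs with h'
        · rfl
        · have : X t + 1 = n := by omega
          simp [g, this]
      rw [e1]
      simp only [g]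
      rw [← ENNReal.ofReal_mul (ω (X t)).2.1.le,
        ← ENNReal.ofReal_add (by positivity) (by positivity)]
      refine ENNReal.ofReal_le_ofReal ?_
      rw [show X t + 1 - n = (X t - n) + 1 by ring, zpow_add_one₀ hK0.ne']
      have h1 : 2 ≤ (ω (X t) : ℝ) * K := by
        rw [hK, mul_div_assoc', le_div_iff₀ hc]; nlinarith [hω (X t)]
      have h2 : 0 < K ^ (X t - n) := by positivity
      nlinarith
    · simp only [h, false_and, if_false]
      rw [mul_one, mul_one, ← ENNReal.ofReal_add (ω (X t)).2.1.le (by linarith [(ω (X t)).2.2])]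
      simp
  have hsum : ∀ N, ∑ t ∈ Finset.range N, ∫⁻ X, A t X ∂(quenchedLaw ω)
      ≤ ∫⁻ X, G N X ∂(quenchedLaw ω) := by
    intro N
    induction N with
    | zero => simp
    | succ N ih =>
      rw [Finset.sum_range_succ, add_comm]
      exact (add_le_add le_rfl ih).trans (hstep N)
  have htop : ∫⁻ X, ∑' t, A t X ∂(quenchedLaw ω) ≠ ⊤ := by
    rw [lintegral_tsum fun t ↦ (hA t).aemeasurable]
    exact ne_top_of_le_ne_top ENNReal.one_ne_top
      (ENNReal.tsum_le_of_sum_range_le fun N ↦ (hsum N).trans (hG1 N))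
  filter_upwards [ae_lt_top (Measurable.tsum hA) htop] with X hX hb
  have h0 := ENNReal.tendsto_atTop_zero_of_tsum_ne_top hX.ne
  refine tendsto_atBot.2 fun b ↦ ?_
  have hgb : 0 < g b := ENNReal.ofReal_pos.2 (by positivity)
  filter_upwards [h0.eventually_lt_const hgb] with t ht
  have hs : StaysBelow n t X := fun s _ ↦ hb s
  simp only [A, hs, if_true] at ht
  by_contra hlt
  refine absurd ht (not_lt.2 (ENNReal.ofReal_le_ofReal ?_))
  exact zpow_le_zpow_right₀ hK1.le (by omega)

open scoped Classical in
/-- If the harmonic function of the environment on `(-∞, n]` is unbounded, the walk reaches `n`. -/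
theorem ae_exists_eq_of_tsum_eq_top {ω : Env} {c : ℝ} (hc : 0 < c) (hω : ∀ x, c ≤ ω x) {n : ℕ}
    (hn : 0 < n) {D : ℕ → ℝ≥0∞} (hD : ∀ i, D i ≠ ⊤)
    (hrec : ∀ i : ℕ, ENNReal.ofReal (1 - ω ((n : ℤ) - 1 - i)) * D (i + 1)
      = ENNReal.ofReal (ω ((n : ℤ) - 1 - i)) * D i)
    (htop : ∑' i, D i = ⊤) :
    ∀ᵐ X ∂(quenchedLaw ω), ∃ t : ℕ, X t = (n : ℤ) := by
  -- Harmonic on (-∞, n) and zero at `n`. Along the walk killed at `n` it has non-increasing mean,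
  -- so by Fatou its liminf is almost surely finite. A path that never hits `n` tends to -∞, where
  -- `h` tends to the divergent sum.
  let h : ℤ → ℝ≥0∞ := fun x ↦ ∑ i ∈ Finset.range ((n : ℤ) - x).toNat, D i
  have hharm : ∀ x : ℤ, x < n → ENNReal.ofReal (ω x) * h (x + 1)
      + ENNReal.ofReal (1 - ω x) * h (x - 1) = h x := by
    intro x hx
    obtain ⟨m, hm⟩ : ∃ m : ℕ, x = n - 1 - m := ⟨(n - 1 - x).toNat, by omega⟩
    have e0 : ((n : ℤ) - x).toNat = m + 1 := by omega
    have e1 : ((n : ℤ) - (x + 1)).toNat = m := by omega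
    have e2 : ((n : ℤ) - (x - 1)).toNat = m + 2 := by omega
    simp only [h, e0, e1, e2, Finset.sum_range_succ]
    set H := ∑ i ∈ Finset.range m, D i
    have hr := hrec m
    rw [← hm] at hr
    have hone : ENNReal.ofReal (ω x) + ENNReal.ofReal (1 - ω x) = 1 := by
      rw [← ENNReal.ofReal_add (ω x).2.1.le (by linarith [(ω x).2.2])]; simp
    rw [mul_add, mul_add, hr]
    calc _ = (ENNReal.ofReal (ω x) + ENNReal.ofReal (1 - ω x)) * (H + D m) := by ring
      _ = _ := by rw [hone, one_mul]
  let V : ℕ → (ℕ → ℤ) → ℝ≥0∞ := fun t X ↦ if StaysBelow n t X then h (X t) else 0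
  have hV : ∀ t, DependsOn (V t) (Iic t) := fun t ↦ dependsOn_ite_staysBelow n t h 0
  have hn0 : h n = 0 := by simp [h]
  have hstep : ∀ t, ∫⁻ X, V (t + 1) X ∂(quenchedLaw ω) ≤ ∫⁻ X, V t X ∂(quenchedLaw ω) := by
    intro t
    rw [lintegral_quenchedLaw_succ ω t (hV (t + 1))]
    refine lintegral_mono fun X ↦ ?_
    simp only [V, staysBelow_update, Function.update_self]
    by_cases hs : StaysBelow n t X
    · simp only [hs, true_and, if_true]
      rw [← hharm (X t) (hs t le_rfl)]
      gcongr
      · split_ifs <;> simp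
      · split_ifs <;> simp
    · simp [hs]
  have hle : ∀ t, ∫⁻ X, V t X ∂(quenchedLaw ω) ≤ h 0 := by
    intro t
    induction t with
    | zero =>
      calc ∫⁻ X, V 0 X ∂(quenchedLaw ω) ≤ ∫⁻ _, h 0 ∂(quenchedLaw ω) := by
            refine lintegral_mono_ae ?_
            filter_upwards [quenchedLaw_ae_zero ω] with X hX
            simp only [V, hX]
            split_ifs <;> simp
        _ = h 0 := by simp
    | succ t ih => exact (hstep t).trans ih
  have hfin : ∫⁻ X, liminf (fun t ↦ V t X) atTop ∂(quenchedLaw ω) ≠ ⊤ := by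
    have h1 := lintegral_liminf_le (μ := quenchedLaw ω) (u := atTop)
      fun t ↦ measurable_of_dependsOn_Iic (hV t)
    refine ne_top_of_le_ne_top ?_ (h1.trans (liminf_le_of_frequently_le'
      (Frequently.of_forall hle)))
    exact ENNReal.sum_ne_top.2 fun i _ ↦ hD i
  have hmeas : Measurable fun X ↦ liminf (fun t ↦ V t X) atTop :=
    Measurable.liminf fun t ↦ measurable_of_dependsOn_Iic (hV t)
  filter_upwards [ae_lt_top hmeas hfin, ae_tendsto_atBot_of_staysBelow hc hω n,
    quenchedLaw_ae_zero ω, quenchedLaw_ae_step ω] with X hX hbot h0 hst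
  by_contra! hne
  have hlt : ∀ t, X t < n := by
    intro t
    induction t with
    | zero => rw [h0]; exact_mod_cast hn
    | succ t ih =>
      have := hne (t + 1)
      rcases hst t with h | h <;> omega
  have hb := hbot hlt
  have hVh : (fun t ↦ V t X) = fun t ↦ h (X t) := by
    ext t
    simp only [V, show StaysBelow n t X from fun s _ ↦ hlt s, if_true]
  have ht : Tendsto (fun t ↦ ((n : ℤ) - X t).toNat) atTop atTop := by
    refine tendsto_atTop.2 fun b ↦ ?_
    filter_upwards [tendsto_atBot.1 hb (n - b)] with t ht
    omega
  have hlim := (ENNReal.tendsto_nat_tsum D).comp ht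
  rw [htop] at hlim
  rw [hVh] at hX
  exact hX.ne hlim.liminf_eq

/-! ### Quenched law of the numbers of left steps -/

/-- The number of steps from `x` to `x - 1` before time `t`. -/
def leftCount (X : ℕ → ℤ) (t x : ℕ) : ℕ :=
  ((Finset.range t).filter fun s ↦ X s = x ∧ X (s + 1) = (x : ℤ) - 1).card

theorem leftCount_succ (X : ℕ → ℤ) (t x : ℕ) : leftCount X (t + 1) x
    = leftCount X t x + if X t = x ∧ X (t + 1) = (x : ℤ) - 1 then 1 else 0 := by
  rw [leftCount, leftCount, Finset.range_add_one, Finset.filter_insert]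
  split_ifs
  · rw [Finset.card_insert_of_notMem (by simp)]
  · rfl

theorem dependsOn_leftCount (t : ℕ) : DependsOn (fun X ↦ leftCount X t) (Iic t) := by
  intro X Y h
  ext x
  simp only [leftCount]
  congr 1
  refine Finset.filter_congr fun s hs ↦ ?_
  have := Finset.mem_range.1 hs
  rw [h s (mem_Iic.2 (by omega)), h (s + 1) (mem_Iic.2 (by omega))]

theorem leftCount_update (X : ℕ → ℤ) (t x : ℕ) (z : ℤ) :
    leftCount (Function.update X (t + 1) z) (t + 1) x
      = leftCount X t x + if X t = x ∧ z = (x : ℤ) - 1 then 1 else 0 := by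
  have h := congrFun (dependsOn_leftCount t (x := Function.update X (t + 1) z) (y := X)
    fun s (hs : s ≤ t) ↦ Function.update_of_ne (by omega) z X) x
  simp only at h
  rw [leftCount_succ, h, Function.update_self, Function.update_of_ne (by omega)]

/-- The probability of `k` failures before the `j`-th success. -/
def nbWeight (j k : ℕ) (w w' : ℝ≥0∞) : ℝ≥0∞ := (j.multichoose k : ℝ≥0∞) * (w ^ j * w' ^ k)

theorem nbWeight_succ_zero (j : ℕ) (w w' : ℝ≥0∞) :
    nbWeight (j + 1) 0 w w' = w * nbWeight j 0 w w' := by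
  simp [nbWeight, pow_succ, mul_comm]

theorem nbWeight_succ_succ (j k : ℕ) (w w' : ℝ≥0∞) :
    nbWeight (j + 1) (k + 1) w w'
      = w * nbWeight j (k + 1) w w' + w' * nbWeight (j + 1) k w w' := by
  simp only [nbWeight, Nat.multichoose_succ_succ, Nat.cast_add]
  ring

/-- The probability, for the walk started at `x`, of making `k y` left steps from each
`y ∈ [0,n)` before reaching `n`. -/
def countProb (ω : Env) (n : ℕ) (x : ℤ) (k : ℕ → ℕ) : ℝ≥0∞ :=
  ∏ y ∈ Finset.range n, nbWeight (k (y + 1) + if x ≤ (y : ℤ) then 1 else 0) (k y)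
    (ENNReal.ofReal (ω y)) (ENNReal.ofReal (1 - ω y))

theorem countProb_of_nonpos (ω : Env) (n : ℕ) {x : ℤ} (hx : x ≤ 0) (k : ℕ → ℕ) :
    countProb ω n x k = countProb ω n 0 k := by
  refine Finset.prod_congr rfl fun y _ ↦ ?_
  simp [show x ≤ (y : ℤ) by omega]

theorem mul_prod_add_mul_prod {ι : Type*} [DecidableEq ι] {s : Finset ι} {m : ι} (hm : m ∈ s)
    {F G₁ G₂ : ι → ℝ≥0∞} {a b : ℝ≥0∞} (h : F m = a * G₁ m + b * G₂ m)
    (h₁ : ∀ y ∈ s, y ≠ m → G₁ y = F y) (h₂ : ∀ y ∈ s, y ≠ m → G₂ y = F y) :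
    a * ∏ y ∈ s, G₁ y + b * ∏ y ∈ s, G₂ y = ∏ y ∈ s, F y := by
  rw [← Finset.mul_prod_erase s G₁ hm, ← Finset.mul_prod_erase s G₂ hm,
    ← Finset.mul_prod_erase s F hm, h,
    Finset.prod_congr rfl fun y hy ↦ h₁ y (Finset.mem_of_mem_erase hy) (Finset.ne_of_mem_erase hy),
    Finset.prod_congr rfl fun y hy ↦ h₂ y (Finset.mem_of_mem_erase hy) (Finset.ne_of_mem_erase hy)]
  ring

/-- The number of right steps from y is forced to be k(y+1), plus one if the walk starts at or below
y. A right step from m removes one success at m only. A left step removes one failure at m; moving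
the start to m - 1 adds a success at m - 1, but lowering k(m) takes it back. So a single factor
changes, and there the identity is the first-trial recursion of `nbWeight`. -/
theorem countProb_harmonic (ω : Env) {n m : ℕ} (hm : m < n) (k : ℕ → ℕ) :
    ENNReal.ofReal (ω m) * countProb ω n (m + 1) k
      + ENNReal.ofReal (1 - ω m) * (if k m = 0 then 0
          else countProb ω n (m - 1) (Function.update k m (k m - 1)))
      = countProb ω n m k := by
  have hmem : m ∈ Finset.range n := Finset.mem_range.2 hm
  have hup : ∀ y ∈ Finset.range n, y ≠ m →
      nbWeight (k (y + 1) + if ((m : ℤ) + 1) ≤ (y : ℤ) then 1 else 0) (k y)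
        (ENNReal.ofReal (ω y)) (ENNReal.ofReal (1 - ω y))
      = nbWeight (k (y + 1) + if (m : ℤ) ≤ (y : ℤ) then 1 else 0) (k y)
        (ENNReal.ofReal (ω y)) (ENNReal.ofReal (1 - ω y)) := by
    intro y _ hy
    have : (m : ℤ) + 1 ≤ y ↔ (m : ℤ) ≤ y := by omega
    simp only [this]
  rcases Nat.eq_zero_or_pos (k m) with h0 | h0
  · have := mul_prod_add_mul_prod hmem (b := 0) (a := ENNReal.ofReal (ω m))
      (G₂ := fun y ↦ nbWeight (k (y + 1) + if (m : ℤ) ≤ (y : ℤ) then 1 else 0) (k y)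
        (ENNReal.ofReal (ω y)) (ENNReal.ofReal (1 - ω y))) ?_ hup (fun _ _ _ ↦ rfl)
    · rw [zero_mul, add_zero] at this
      rw [if_pos h0, mul_zero, add_zero]
      exact this
    · simp [h0, nbWeight_succ_zero]
  · obtain ⟨j, hj⟩ := Nat.exists_eq_succ_of_ne_zero h0.ne'
    rw [if_neg h0.ne']
    refine mul_prod_add_mul_prod hmem ?_ hup ?_
    · simp [hj, nbWeight_succ_succ]
    · intro y _ hy
      rw [Function.update_of_ne hy]
      by_cases hy' : y + 1 = m
      · subst hy'
        rw [Function.update_self, if_pos (by push_cast; omega), if_neg (by push_cast; omega),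
          add_zero, Nat.sub_add_cancel h0]
      · have : (m : ℤ) - 1 ≤ y ↔ (m : ℤ) ≤ y := by omega
        rw [Function.update_of_ne hy']
        simp only [this]

open scoped Classical in
/-- The quenched law of the numbers of left steps before `T_n`. -/
theorem quenchedLaw_leftCount_le (ω : Env) {n : ℕ} (hn : 0 < n) {ℓ : ℕ → ℕ} (hℓ : ℓ n = 0) :
    quenchedLaw ω {X | ∃ t, (∀ s < t, X s < n) ∧ X t = n ∧ ∀ y < n, leftCount X t y = ℓ y}
      ≤ ∏ y ∈ Finset.range n, nbWeight (ℓ (y + 1) + 1) (ℓ y)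
          (ENNReal.ofReal (ω y)) (ENNReal.ofReal (1 - ω y)) := by
  -- `V t` is the candidate for the conditional probability of completing the prescribed counts from
  -- time t; `I t` marks the completion at time t + 1. The one-step inequality E[I t + V (t+1)] ≤
  -- E[V t] telescopes to Σ E[I t] ≤ E[V 0].
  let V : ℕ → (ℕ → ℤ) → ℝ≥0∞ := fun t X ↦
    if StaysBelow n t X ∧ ∀ y < n, leftCount X t y ≤ ℓ y then
      countProb ω n (X t) (fun y ↦ ℓ y - leftCount X t y) else 0
  let I : ℕ → (ℕ → ℤ) → ℝ≥0∞ := fun t X ↦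
    if StaysBelow n t X ∧ X (t + 1) = n ∧ ∀ y < n, leftCount X (t + 1) y = ℓ y then 1 else 0
  have hV : ∀ t, DependsOn (V t) (Iic t) := fun t X Y h ↦ by
    have e := dependsOn_leftCount t h
    simp only at e
    simp only [V, dependsOn_staysBelow n t h, h t (mem_Iic.2 le_rfl), e]
  have hI : ∀ t, DependsOn (I t) (Iic (t + 1)) := fun t X Y h ↦ by
    have e := dependsOn_leftCount (t + 1) h
    simp only at e
    simp only [I, dependsOn_staysBelow n t (fun s hs ↦ h s (mem_Iic.2 (le_trans hs (Nat.le_succ t)))),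
      h (t + 1) (mem_Iic.2 le_rfl), e]
  have hIV : ∀ t, DependsOn (fun X ↦ I t X + V (t + 1) X) (Iic (t + 1)) := fun t X Y h ↦ by
    simp only [hI t h, hV (t + 1) h]
  have hstep : ∀ t, ∫⁻ X, I t X ∂(quenchedLaw ω) + ∫⁻ X, V (t + 1) X ∂(quenchedLaw ω)
      ≤ ∫⁻ X, V t X ∂(quenchedLaw ω) := by
    intro t
    rw [← lintegral_add_left (measurable_of_dependsOn_Iic (hI t)),
      lintegral_quenchedLaw_succ ω t (hIV t)]
    refine lintegral_mono fun X ↦ ?_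
    have hbel : ∀ z, StaysBelow n t (Function.update X (t + 1) z) ↔ StaysBelow n t X := fun z ↦
      iff_of_eq (dependsOn_staysBelow n t
        fun s (hs : s ≤ t) ↦ Function.update_of_ne (by omega) z X)
    simp only [I, V, hbel, staysBelow_update, Function.update_self, leftCount_update]
    by_cases hs : StaysBelow n t X; swap
    · simp [hs]
    have hX : X t < n := hs t le_rfl
    simp only [hs, true_and]
    by_cases hc : ∀ y < n, leftCount X t y ≤ ℓ y; swap
    · push Not at hc
      obtain ⟨y, hy, hlt⟩ := hc
      have h1 : ∀ f : ℕ → ℕ, ¬ (∀ y < n, leftCount X t y + f y ≤ ℓ y) := fun f h ↦ by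
        have := h y hy; omega
      have h2 : ∀ f : ℕ → ℕ, ¬ (∀ y < n, leftCount X t y + f y = ℓ y) := fun f h ↦ by
        have := h y hy; omega
      simp [h1, h2]
    rw [if_pos hc]
    set k : ℕ → ℕ := fun y ↦ ℓ y - leftCount X t y with hk
    have hnoup : ∀ y : ℕ, ¬ (X t = y ∧ X t + 1 = (y : ℤ) - 1) := fun y ↦ by omega
    -- A right step never alters the counts. If it lands on `n`, `V` vanishes and `I` requires all
    -- remaining counts to be zero, including the one at `n`, where `ℓ n = 0` is used; then every
    -- factor equals 1.
    have hup : ((if X t + 1 = n ∧ ∀ y < n, leftCount X t y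
          + (if X t = y ∧ X t + 1 = (y : ℤ) - 1 then 1 else 0) = ℓ y then 1 else 0)
        + if X t + 1 < n ∧ ∀ y < n, leftCount X t y
          + (if X t = y ∧ X t + 1 = (y : ℤ) - 1 then 1 else 0) ≤ ℓ y then
          countProb ω n (X t + 1) (fun y ↦ ℓ y - (leftCount X t y
            + if X t = y ∧ X t + 1 = (y : ℤ) - 1 then 1 else 0)) else 0 : ℝ≥0∞)
        ≤ countProb ω n (X t + 1) k := by
      simp only [hnoup, if_false, add_zero]
      rcases (show X t + 1 ≤ n by omega).lt_or_eq with h | h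
      · rw [if_neg (fun hh ↦ h.ne hh.1), if_pos ⟨h, hc⟩, zero_add]
      · have hno : ¬ X t + 1 < n := h.not_lt
        simp only [hno, false_and, if_false, add_zero]
        split_ifs with hh
        · have hz : ∀ y ≤ n, k y = 0 := fun y hy ↦ by
            rcases hy.lt_or_eq with hy | rfl
            · simp [hk, hh.2 y hy]
            · simp [hk, hℓ]
          refine le_of_eq (Eq.symm (Finset.prod_eq_one fun y hy ↦ ?_))
          have hy := Finset.mem_range.1 hy
          rw [hz y hy.le, hz (y + 1) hy, if_neg (by omega)]
          simp [nbWeight]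
        · exact zero_le
    rw [if_neg (c := X t - 1 = n ∧ _) (fun hh ↦ by omega), zero_add]
    refine (add_le_add (mul_le_mul_right hup _) le_rfl).trans ?_
    rcases lt_or_ge (X t) 0 with hneg | hpos
    -- To the left of 0 no step is counted and `countProb` does not depend on the position, so both
    -- moves keep its value.
    · have hno : ∀ y : ℕ, ¬ (X t = y ∧ X t - 1 = (y : ℤ) - 1) := fun y ↦ by omega
      simp only [hno, if_false, add_zero]
      rw [if_pos ⟨by omega, hc⟩, countProb_of_nonpos ω n (by omega) k, ← hk,
        countProb_of_nonpos ω n (show X t - 1 ≤ 0 by omega) k,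
        countProb_of_nonpos ω n (show X t ≤ 0 by omega) k, ← add_mul,
        ← ENNReal.ofReal_add (ω (X t)).2.1.le (by linarith [(ω (X t)).2.2])]
      simp
    · obtain ⟨m, hm⟩ := Int.eq_ofNat_of_zero_le hpos
      have hmn : m < n := by omega
      rw [hm, ← countProb_harmonic ω hmn k]
      refine add_le_add le_rfl (mul_le_mul_right ?_ _)
      split_ifs with h1 h2
      · have := h1.2 m hmn
        simp only [hk] at h2
        simp at this
        omega
      · refine le_of_eq ?_
        congr 1
        ext y
        by_cases hy : y = m
        · subst hy
          simp [hk]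
          omega
        · rw [Function.update_of_ne hy, if_neg (by omega)]
          simp [hk]
      · exact zero_le
      · exact zero_le
  have hsum : ∀ N, ∑ t ∈ Finset.range N, ∫⁻ X, I t X ∂(quenchedLaw ω)
      + ∫⁻ X, V N X ∂(quenchedLaw ω) ≤ ∫⁻ X, V 0 X ∂(quenchedLaw ω) := by
    intro N
    induction N with
    | zero => simp
    | succ N ih =>
      rw [Finset.sum_range_succ, add_assoc]
      exact (add_le_add le_rfl (hstep N)).trans ih
  have h0 : ∫⁻ X, V 0 X ∂(quenchedLaw ω) ≤ countProb ω n 0 ℓ := by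
    calc ∫⁻ X, V 0 X ∂(quenchedLaw ω) ≤ ∫⁻ _, countProb ω n 0 ℓ ∂(quenchedLaw ω) := by
          refine lintegral_mono_ae ?_
          filter_upwards [quenchedLaw_ae_zero ω] with X hX
          simp only [V, hX, leftCount, Finset.range_zero, Finset.filter_empty, Finset.card_empty,
            Nat.sub_zero]
          split_ifs <;> simp
      _ = _ := by simp
  have hfin : countProb ω n 0 ℓ = ∏ y ∈ Finset.range n, nbWeight (ℓ (y + 1) + 1) (ℓ y)
      (ENNReal.ofReal (ω y)) (ENNReal.ofReal (1 - ω y)) := by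
    simp [countProb]
  rw [← hfin]
  calc quenchedLaw ω {X | ∃ t, (∀ s < t, X s < n) ∧ X t = n ∧ ∀ y < n, leftCount X t y = ℓ y}
      ≤ ∫⁻ X, ∑' t, I t X ∂(quenchedLaw ω) := by
        have hm : Measurable fun X ↦ ∑' t, I t X :=
          Measurable.tsum fun t ↦ measurable_of_dependsOn_Iic (hI t)
        have h1 := mul_meas_ge_le_lintegral (μ := quenchedLaw ω) hm 1
        rw [one_mul] at h1
        refine le_trans (measure_mono_ae ?_) h1
        filter_upwards [quenchedLaw_ae_zero ω] with X h0 ⟨t, h1, h2, h3⟩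
        cases t with
        | zero => omega
        | succ t =>
          have h4 : I t X = 1 := if_pos ⟨fun s hs ↦ h1 s (by omega), h2, h3⟩
          show 1 ≤ ∑' t, I t X
          rw [← h4]
          exact ENNReal.le_tsum t
    _ = ∑' t, ∫⁻ X, I t X ∂(quenchedLaw ω) :=
        lintegral_tsum fun t ↦ (measurable_of_dependsOn_Iic (hI t)).aemeasurable
    _ ≤ countProb ω n 0 ℓ := ENNReal.tsum_le_of_sum_range_le fun N ↦
        (le_self_add.trans (hsum N)).trans h0

/-! ### The i.i.d. environment and transience to the right -/

theorem iIndepFun_env {ν : Measure (Ioo (0 : ℝ) 1)} [IsProbabilityMeasure ν] {β : Type*}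
    [MeasurableSpace β] {e : ℕ → ℤ} (he : Function.Injective e)
    {f : ℕ → Ioo (0 : ℝ) 1 → β} (hf : ∀ i, Measurable (f i)) :
    iIndepFun (fun i (ω : Env) ↦ f i (ω (e i))) (envLaw ν) := by
  have h : iIndepFun (fun (x : ℤ) (ω : Env) ↦ ω x) (envLaw ν) :=
    iIndepFun_infinitePi (P := fun _ : ℤ ↦ ν) (X := fun _ ω ↦ ω) (fun _ ↦ measurable_id)
  exact (h.precomp he).comp f hf

theorem lintegral_env_eval {ν : Measure (Ioo (0 : ℝ) 1)} [IsProbabilityMeasure ν] (x : ℤ)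
    {f : Ioo (0 : ℝ) 1 → ℝ≥0∞} (hf : Measurable f) :
    ∫⁻ ω : Env, f (ω x) ∂(envLaw ν) = ∫⁻ y, f y ∂ν :=
  (measurePreserving_eval_infinitePi (fun _ : ℤ ↦ ν) x).lintegral_comp hf

theorem lintegral_env_prod {ν : Measure (Ioo (0 : ℝ) 1)} [IsProbabilityMeasure ν]
    {e : ℕ → ℤ} (he : Function.Injective e) {f : ℕ → Ioo (0 : ℝ) 1 → ℝ≥0∞}
    (hf : ∀ i, Measurable (f i)) (n : ℕ) :
    ∫⁻ ω : Env, ∏ i ∈ Finset.range n, f i (ω (e i)) ∂(envLaw ν)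
      = ∏ i ∈ Finset.range n, ∫⁻ y, f i y ∂ν := by
  rw [lintegral_prod_eq_prod_lintegral_of_indepFun (Finset.range n)
    (fun i (ω : Env) ↦ f i (ω (e i))) (iIndepFun_env he hf)
    (fun i ↦ (hf i).comp (measurable_pi_apply _))]
  exact Finset.prod_congr rfl fun i _ ↦ lintegral_env_eval (e i) (hf i)

variable {p a : ℝ}

theorem ae_env_temkin (h0 : 0 ≤ p) (h1 : p ≤ 1) (ha : a ∈ Ioo (0 : ℝ) 1) :
    ∀ᵐ ω ∂(envLaw (temkin p a)), ∀ x, ((ω x : ℝ) = a ∨ (ω x : ℝ) = 1 - a) := by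
  have := isProbabilityMeasure_temkin h0 h1 ha
  refine ae_all_iff.2 fun x ↦ ?_
  have h : ∀ᵐ y : Ioo (0 : ℝ) 1 ∂(temkin p a), ((y : ℝ) = a ∨ (y : ℝ) = 1 - a) := by
    have e := temkin_eq p ⟨a, ha⟩
    simp only at e
    rw [e, ae_add_measure_iff]
    exact ⟨Measure.ae_smul_measure (by rw [ae_dirac_eq]; simp) _,
      Measure.ae_smul_measure (by rw [ae_dirac_eq]; simp [reflect]) _⟩
  exact (measurePreserving_eval_infinitePi (fun _ : ℤ ↦ temkin p a) x).quasiMeasurePreserving.ae h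

theorem rho_pos (ω : Env) (x : ℤ) : 0 < rho ω x :=
  div_pos (by linarith [(ω x).2.2]) (ω x).2.1

/-- The logarithm of `ρ` has a negative mean, hence the products of the `ρ`'s decay
exponentially. -/
theorem exists_ae_prod_rho_le (h0 : 0 < p) (h1 : p < 1 / 2) (ha0 : 0 < a) (ha1 : a < 1 / 2) :
    ∃ θ : ℝ, 0 < θ ∧ θ < 1 ∧ ∀ e : ℕ → ℤ, Function.Injective e →
      ∀ᵐ ω ∂(envLaw (temkin p a)), ∀ᶠ k in atTop, ∏ i ∈ Finset.range k, rho ω (e i) ≤ θ ^ k := by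
  have ha : a ∈ Ioo (0 : ℝ) 1 := ⟨ha0, by linarith⟩
  have := isProbabilityMeasure_temkin h0.le (by linarith) ha
  let L : Ioo (0 : ℝ) 1 → ℝ := fun y ↦ Real.log ((1 - (y : ℝ)) / y)
  have hL : Measurable L := by fun_prop
  have hLi : Integrable L (temkin p a) := by
    have e := temkin_eq p ⟨a, ha⟩
    simp only at e
    rw [e]
    exact ((integrable_dirac (by simp)).smul_measure (by simp)).add_measure
      ((integrable_dirac (by simp)).smul_measure (by simp))
  set m := ∫ y, L y ∂(temkin p a) with hm
  -- The mean is (2p - 1) log ((1-a)/a), negative because p < 1/2 and a < 1/2. Exponentiating half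
  -- of it below leaves room for the strong law.
  have hneg : m < 0 := by
    rw [hm, integral_temkin h0.le (by linarith) ha]
    simp only [L, reflect, sub_sub_cancel]
    rw [← inv_div (1 - a) a, Real.log_inv]
    have : 0 < Real.log ((1 - a) / a) := Real.log_pos (by rw [lt_div_iff₀ ha0]; linarith)
    nlinarith
  refine ⟨Real.exp (m / 2), Real.exp_pos _, Real.exp_lt_one_iff.2 (by linarith), fun e he ↦ ?_⟩
  have hmp : ∀ x : ℤ, MeasurePreserving (fun ω : Env ↦ ω x) (envLaw (temkin p a)) (temkin p a) :=
    fun x ↦ measurePreserving_eval_infinitePi (fun _ : ℤ ↦ temkin p a) x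
  have hlaw := strong_law_ae_real (μ := envLaw (temkin p a)) (fun i (ω : Env) ↦ L (ω (e i)))
    ((hmp _).integrable_comp_of_integrable hLi)
    (fun i j hij ↦ (iIndepFun_env he (fun _ ↦ hL)).indepFun hij)
    (fun i ↦ ⟨(hL.comp (hmp _).measurable).aemeasurable, (hL.comp (hmp _).measurable).aemeasurable, by
      have h : ∀ x : ℤ, (envLaw (temkin p a)).map (fun ω : Env ↦ L (ω x)) = (temkin p a).map L := by
        intro x
        conv_rhs => rw [← (hmp x).map_eq, Measure.map_map hL (hmp x).measurable]
        rfl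
      rw [h, h]⟩)
  have hmean : ∫ ω : Env, L (ω (e 0)) ∂(envLaw (temkin p a)) = m := by
    have := integral_map (μ := envLaw (temkin p a)) (φ := fun ω : Env ↦ ω (e 0))
      (hmp _).measurable.aemeasurable (f := L) hL.aestronglyMeasurable
    rw [← this, (hmp _).map_eq]
  rw [hmean] at hlaw
  filter_upwards [hlaw] with ω hω
  filter_upwards [hω.eventually_lt_const (show m < m / 2 by linarith), eventually_gt_atTop 0]
    with k hk hk0
  have hk0' : (0 : ℝ) < k := by exact_mod_cast hk0
  rw [div_lt_iff₀ hk0'] at hk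
  rw [← Real.exp_nat_mul, ← Real.log_le_iff_le_exp (Finset.prod_pos fun i _ ↦ rho_pos ω _),
    Real.log_prod (fun i _ ↦ (rho_pos ω _).ne')]
  calc _ ≤ m / 2 * k := hk.le
    _ = _ := mul_comm _ _

theorem prod_Icc_rho (ω : Env) (k : ℕ) :
    ∏ i ∈ Finset.Icc 1 k, rho ω (i : ℤ) = ∏ i ∈ Finset.range k, rho ω ((i : ℤ) + 1) := by
  induction k with
  | zero => simp
  | succ k ih => rw [Finset.prod_Icc_succ_top (by omega), ih, Finset.prod_range_succ]; simp

theorem ae_summable_prod_rho (h0 : 0 < p) (h1 : p < 1 / 2) (ha0 : 0 < a) (ha1 : a < 1 / 2) :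
    ∀ᵐ ω ∂(envLaw (temkin p a)), Summable fun k : ℕ ↦ ∏ i ∈ Finset.Icc 1 k, rho ω (i : ℤ) := by
  obtain ⟨θ, hθ0, hθ1, h⟩ := exists_ae_prod_rho_le h0 h1 ha0 ha1
  filter_upwards [h (fun i ↦ (i : ℤ) + 1) (fun i j hij ↦ by simpa using hij)] with ω hω
  refine Summable.of_norm_bounded_eventually_nat (summable_geometric_of_lt_one hθ0.le hθ1) ?_
  filter_upwards [hω] with k hk
  rw [prod_Icc_rho, Real.norm_of_nonneg (Finset.prod_nonneg fun i _ ↦ (rho_pos ω _).le)]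
  exact hk

/-- The increments of the harmonic function to the left of n are the inverses of products of ρ. The
products are eventually at most θ^k ≤ 1, so the increments do not tend to 0 and their sum diverges.
-/
theorem ae_env_quenchedLaw_hits (h0 : 0 < p) (h1 : p < 1 / 2) (ha0 : 0 < a) (ha1 : a < 1 / 2)
    {n : ℕ} (hn : 0 < n) : ∀ᵐ ω ∂(envLaw (temkin p a)),
      ∀ᵐ X : ℕ → ℤ ∂(quenchedLaw ω), ∃ t : ℕ, X t = (n : ℤ) := by
  obtain ⟨θ, hθ0, hθ1, h⟩ := exists_ae_prod_rho_le h0 h1 ha0 ha1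
  filter_upwards [h (fun i ↦ (n : ℤ) - 1 - i) (fun i j hij ↦ by simpa using hij),
    ae_env_temkin h0.le (by linarith) ⟨ha0, by linarith⟩] with ω hω hval
  have hpos : ∀ k, 0 < ∏ i ∈ Finset.range k, rho ω ((n : ℤ) - 1 - i) := fun k ↦
    Finset.prod_pos fun i _ ↦ rho_pos ω _
  refine ae_exists_eq_of_tsum_eq_top ha0 (fun x ↦ ?_) hn
    (D := fun k ↦ ENNReal.ofReal (∏ i ∈ Finset.range k, rho ω ((n : ℤ) - 1 - i))⁻¹)
    (fun k ↦ ENNReal.ofReal_ne_top) (fun k ↦ ?_) ?_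
  · rcases hval x with h | h <;> linarith
  · have hw := (ω ((n : ℤ) - 1 - k)).2
    rw [← ENNReal.ofReal_mul (by linarith [hw.2]), ← ENNReal.ofReal_mul hw.1.le,
      Finset.prod_range_succ]
    congr 1
    have h1 : (0 : ℝ) < 1 - ω ((n : ℤ) - 1 - k) := by linarith [hw.2]
    have h2 := hw.1.ne'
    have h3 := (hpos k).ne'
    have h4 := h1.ne'
    rw [rho.eq_def ω ((n : ℤ) - 1 - k)]
    field_simp
  · by_contra hne
    have ht := ENNReal.tendsto_atTop_zero_of_tsum_ne_top hne
    obtain ⟨k, hk1, hk2⟩ := (hω.and (ht.eventually_lt_const zero_lt_one)).exists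
    refine absurd hk2 (not_lt.2 ?_)
    rw [← ENNReal.ofReal_one]
    refine ENNReal.ofReal_le_ofReal ?_
    rw [one_le_inv₀ (hpos k)]
    exact hk1.trans (pow_le_one₀ hθ0.le hθ1.le)

/-! ### The annealed law of the left steps as a Markov chain -/

theorem annealedLaw_apply {ν : Measure (Ioo (0 : ℝ) 1)} {s : Set (ℕ → ℤ)} (hs : MeasurableSet s) :
    annealedLaw ν s = ∫⁻ ω, quenchedLaw ω s ∂(envLaw ν) := by
  rw [annealedLaw, Measure.bind_apply hs quenchedKernel.measurable.aemeasurable]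
  rfl

theorem ae_annealedLaw {ν : Measure (Ioo (0 : ℝ) 1)} {P : (ℕ → ℤ) → Prop}
    (hP : MeasurableSet {X | P X}) (h : ∀ᵐ ω ∂(envLaw ν), ∀ᵐ X ∂(quenchedLaw ω), P X) :
    ∀ᵐ X ∂(annealedLaw ν), P X := by
  rw [ae_iff, show {X | ¬ P X} = {X | P X}ᶜ from rfl, annealedLaw_apply hP.compl]
  exact lintegral_eq_zero_of_ae_eq_zero (by filter_upwards [h] with ω hω using hω)

theorem nbWeight_ofReal {x : ℝ} (h0 : 0 < x) (h1 : x < 1) (u v : ℕ) :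
    nbWeight (u + 1) v (ENNReal.ofReal x) (ENNReal.ofReal (1 - x)) = ENNReal.ofReal (nbMass x u v) := by
  have h2 : 0 ≤ 1 - x := by linarith
  rw [nbWeight, nbMass, ENNReal.ofReal_mul (by positivity), ENNReal.ofReal_mul (by positivity),
    ENNReal.ofReal_pow h0.le, ENNReal.ofReal_pow h2, ENNReal.ofReal_natCast, Nat.multichoose_eq]
  congr 4
  omega

theorem lintegral_nbWeight_temkin (h0 : 0 ≤ p) (h1 : p ≤ 1) (ha : a ∈ Ioo (0 : ℝ) 1) (u v : ℕ) :
    ∫⁻ x : Ioo (0 : ℝ) 1, nbWeight (u + 1) v (ENNReal.ofReal x) (ENNReal.ofReal (1 - x))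
      ∂(temkin p a) = ENNReal.ofReal (Q (temkin p a) u v) := by
  have ha' : 1 - a ∈ Ioo (0 : ℝ) 1 := (reflect ⟨a, ha⟩).2
  rw [lintegral_temkin ha, nbWeight_ofReal ha.1 ha.2, reflect, nbWeight_ofReal ha'.1 ha'.2,
    Q_temkin h0 h1 ha, ← ENNReal.ofReal_mul h0, ← ENNReal.ofReal_mul (by linarith),
    ← ENNReal.ofReal_add (mul_nonneg h0 (nbMass_nonneg ha.1 ha.2 u v))
      (mul_nonneg (by linarith) (nbMass_nonneg ha'.1 ha'.2 u v))]

/-- The quenched bound has one factor per site, depending only on the environment there.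
Independence turns its mean into a product, and averaging a negative binomial mass over the
two-point law gives `Q`. -/
theorem annealedLaw_leftCount_le (h0 : 0 ≤ p) (h1 : p ≤ 1) (ha : a ∈ Ioo (0 : ℝ) 1) {n : ℕ}
    (hn : 0 < n) {ℓ : ℕ → ℕ} (hℓ : ℓ n = 0) :
    annealedLaw (temkin p a)
        {X | ∃ t : ℕ, (∀ s < t, X s < n) ∧ X t = (n : ℤ) ∧ ∀ y < n, leftCount X t y = ℓ y}
      ≤ ∏ y ∈ Finset.range n, ENNReal.ofReal (Q (temkin p a) (ℓ (y + 1)) (ℓ y)) := by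
  have := isProbabilityMeasure_temkin h0 h1 ha
  have hm : MeasurableSet {X : ℕ → ℤ | ∃ t : ℕ, (∀ s < t, X s < n) ∧ X t = (n : ℤ)
      ∧ ∀ y < n, leftCount X t y = ℓ y} := by
    rw [ofPred_exists]
    refine MeasurableSet.iUnion fun t ↦ ?_
    refine measurableSet_setOfPred.2 (measurable_of_dependsOn_Iic (N := t) fun X Y h ↦ ?_)
    have e := dependsOn_leftCount t h
    simp only at e
    simp only [e, h t (mem_Iic.2 le_rfl), eq_iff_iff]
    refine and_congr_left fun _ ↦ forall₂_congr fun s hs ↦ ?_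
    rw [h s (mem_Iic.2 hs.le)]
  rw [annealedLaw_apply hm]
  refine (lintegral_mono fun ω ↦ quenchedLaw_leftCount_le ω hn hℓ).trans ?_
  have hmeas : ∀ y : ℕ, Measurable fun x : Ioo (0 : ℝ) 1 ↦
      nbWeight (ℓ (y + 1) + 1) (ℓ y) (ENNReal.ofReal x) (ENNReal.ofReal (1 - x)) := by
    intro y; unfold nbWeight; fun_prop
  have h := lintegral_env_prod (ν := temkin p a) (e := fun y : ℕ ↦ (y : ℤ)) Nat.cast_injective
    hmeas n
  simp only [lintegral_nbWeight_temkin h0 h1 ha] at h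
  exact h.le

/-- Almost surely the level is reached, and a nearest-neighbour path cannot jump over it. The counts
before the hitting time thus become finite-time counts. -/
theorem ae_annealedLaw_exists_leftSteps_eq (h0 : 0 < p) (h1 : p < 1 / 2) (ha0 : 0 < a)
    (ha1 : a < 1 / 2) {n : ℕ} (hn : 0 < n) : ∀ᵐ X : ℕ → ℤ ∂(annealedLaw (temkin p a)),
      ∃ t : ℕ, (∀ s < t, X s < n) ∧ X t = (n : ℤ) ∧ ∀ y, leftSteps X n y = leftCount X t y := by
  have hhit : ∀ᵐ X : ℕ → ℤ ∂(annealedLaw (temkin p a)), ∃ t : ℕ, X t = (n : ℤ) := by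
    refine ae_annealedLaw ?_ (ae_env_quenchedLaw_hits h0 h1 ha0 ha1 hn)
    rw [ofPred_exists]
    exact MeasurableSet.iUnion fun t ↦
      measurableSet_eq_fun (measurable_pi_apply t) measurable_const
  have hstart : ∀ᵐ X : ℕ → ℤ ∂(annealedLaw (temkin p a)), X 0 = 0 :=
    ae_annealedLaw (measurableSet_eq_fun (measurable_pi_apply 0) measurable_const)
      (ae_of_all _ quenchedLaw_ae_zero)
  have hnn : ∀ᵐ X : ℕ → ℤ ∂(annealedLaw (temkin p a)),
      ∀ t : ℕ, X (t + 1) = X t + 1 ∨ X (t + 1) = X t - 1 := by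
    refine ae_annealedLaw ?_ (ae_of_all _ quenchedLaw_ae_step)
    rw [ofPred_forall]
    refine MeasurableSet.iInter fun t ↦ MeasurableSet.union ?_ ?_
    · exact measurableSet_eq_fun (measurable_pi_apply _) ((measurable_pi_apply t).add_const 1)
    · exact measurableSet_eq_fun (measurable_pi_apply _) ((measurable_pi_apply t).sub_const 1)
  filter_upwards [hhit, hstart, hnn] with X hX hX0 hst
  classical
  obtain ⟨t, ht, hmin⟩ : ∃ t : ℕ, X t = (n : ℤ) ∧ ∀ s < t, X s ≠ (n : ℤ) :=
    ⟨Nat.find hX, Nat.find_spec hX, fun s hs ↦ Nat.find_min hX hs⟩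
  have hlt : ∀ s < t, X s < n := by
    intro s
    induction s with
    | zero => intro _; rw [hX0]; exact_mod_cast hn
    | succ s ih =>
      intro hs
      have := ih (by omega)
      have := hmin (s + 1) hs
      rcases hst s with h | h <;> omega
  refine ⟨t, hlt, ht, fun y ↦ ?_⟩
  have hT : hittingTime X n = t := by
    refine le_antisymm (iInf₂_le t ht) (le_iInf₂ fun s hs ↦ ?_)
    by_contra! hlt'
    exact hmin s (by exact_mod_cast hlt') hs
  rw [leftSteps, leftCount, hT, ← Set.ncard_coe_finset]
  congr 1
  ext s
  simp

/-- The sequence `(ℓ 0, …, ℓ (n-1), u, u, …)`. -/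
def extendTuple {n : ℕ} (ℓ : Fin n → ℕ) (u y : ℕ) : ℕ := if h : y < n then ℓ ⟨y, h⟩ else u

theorem ae_annealedLaw_leftSteps_self (h0 : 0 < p) (h1 : p < 1 / 2) (ha0 : 0 < a)
    (ha1 : a < 1 / 2) {n : ℕ} (hn : 0 < n) : ∀ᵐ X : ℕ → ℤ ∂(annealedLaw (temkin p a)),
      ∀ y ≤ n, leftSteps X n y = extendTuple (fun i : Fin n ↦ leftSteps X n i) 0 y := by
  filter_upwards [ae_annealedLaw_exists_leftSteps_eq h0 h1 ha0 ha1 hn] with X ⟨t, h1, _, h3⟩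
  intro y hy
  rcases hy.lt_or_eq with hy | rfl
  · simp [extendTuple, hy]
  · rw [h3, leftCount, Finset.card_eq_zero.2]
    · simp [extendTuple]
    · refine Finset.filter_eq_empty_iff.2 fun s hs hh ↦ ?_
      have := h1 s (Finset.mem_range.1 hs)
      omega

/-- The law of `(L_0^n, …, L_{n-1}^n)` under the annealed law is that of a Markov chain. -/
theorem annealedLaw_leftSteps_mem_le (h0 : 0 < p) (h1 : p < 1 / 2) (ha0 : 0 < a)
    (ha1 : a < 1 / 2) {n : ℕ} (hn : 0 < n) (B : Set (Fin n → ℕ)) :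
    annealedLaw (temkin p a) {X | (fun i : Fin n ↦ leftSteps X n i) ∈ B}
      ≤ ∑' ℓ : Fin n → ℕ, B.indicator (fun ℓ ↦ ∏ y ∈ Finset.range n, ENNReal.ofReal
          (Q (temkin p a) (extendTuple ℓ 0 (y + 1)) (extendTuple ℓ 0 y))) ℓ := by
  calc annealedLaw (temkin p a) {X | (fun i : Fin n ↦ leftSteps X n i) ∈ B}
      ≤ annealedLaw (temkin p a) (⋃ ℓ : B, {X | ∃ t : ℕ, (∀ s < t, X s < n) ∧ X t = (n : ℤ)
          ∧ ∀ y < n, leftCount X t y = extendTuple ℓ.1 0 y}) := by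
        refine measure_mono_ae ?_
        filter_upwards [ae_annealedLaw_exists_leftSteps_eq h0 h1 ha0 ha1 hn] with X ⟨t, h1, h2, h3⟩ hX
        refine mem_iUnion.2 ⟨⟨_, hX⟩, t, h1, h2, fun y hy ↦ ?_⟩
        rw [← h3]
        simp [extendTuple, hy]
    _ ≤ ∑' ℓ : B, annealedLaw (temkin p a) {X | ∃ t : ℕ, (∀ s < t, X s < n) ∧ X t = (n : ℤ)
          ∧ ∀ y < n, leftCount X t y = extendTuple ℓ.1 0 y} := measure_iUnion_le _
    _ ≤ ∑' ℓ : B, ∏ y ∈ Finset.range n, ENNReal.ofReal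
          (Q (temkin p a) (extendTuple ℓ.1 0 (y + 1)) (extendTuple ℓ.1 0 y)) :=
        ENNReal.tsum_le_tsum fun ℓ ↦ annealedLaw_leftCount_le h0.le (by linarith)
          ⟨ha0, by linarith⟩ hn (by simp [extendTuple])
    _ = _ := tsum_subtype B fun ℓ ↦ ∏ y ∈ Finset.range n, ENNReal.ofReal
          (Q (temkin p a) (extendTuple ℓ 0 (y + 1)) (extendTuple ℓ 0 y))

/-- The total mass of the `n`-step paths from `u` weighted by the kernels `K (n-1), …, K 0`. -/
def chainSum (K : ℕ → ℕ → ℕ → ℝ≥0∞) : ℕ → ℕ → ℝ≥0∞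
  | 0, _ => 1
  | n + 1, u => ∑' v, K n u v * chainSum K n v

theorem tsum_prod_eq_chainSum (K : ℕ → ℕ → ℕ → ℝ≥0∞) (n u : ℕ) :
    ∑' ℓ : Fin n → ℕ, ∏ y ∈ Finset.range n, K y (extendTuple ℓ u (y + 1)) (extendTuple ℓ u y)
      = chainSum K n u := by
  induction n generalizing u with
  | zero => simp [chainSum]
  | succ n ih =>
    -- The chain runs from site n down to 0, so the last coordinate is its first step out of `u`.
    rw [← (Fin.snocEquiv fun _ ↦ ℕ).tsum_eq, ENNReal.tsum_prod', chainSum]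
    refine tsum_congr fun v ↦ ?_
    rw [← ih v, ← ENNReal.tsum_mul_left]
    refine tsum_congr fun ℓ ↦ ?_
    have e1 : ∀ y ≤ n, extendTuple ((Fin.snocEquiv fun _ : Fin (n + 1) ↦ ℕ) (v, ℓ)) u y
        = extendTuple ℓ v y := by
      intro y hy
      simp only [Fin.snocEquiv, Equiv.coe_fn_mk, extendTuple, dif_pos (Nat.lt_succ_of_le hy),
        Fin.snoc]
      split_ifs <;> rfl
    rw [Finset.prod_range_succ, mul_comm]
    congr 1
    · rw [e1 n le_rfl]
      simp [extendTuple]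
    · refine Finset.prod_congr rfl fun y hy ↦ ?_
      have hy := Finset.mem_range.1 hy
      rw [e1 y hy.le, e1 (y + 1) hy]

theorem chainSum_le {K : ℕ → ℕ → ℕ → ℝ≥0∞} {c : ℕ → ℝ≥0∞} (h : ∀ n u, ∑' v, K n u v ≤ c n)
    (n u : ℕ) : chainSum K n u ≤ ∏ i ∈ Finset.range n, c i := by
  induction n generalizing u with
  | zero => simp [chainSum]
  | succ n ih =>
    rw [chainSum, Finset.prod_range_succ, mul_comm]
    calc _ ≤ ∑' v, K n u v * ∏ i ∈ Finset.range n, c i :=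
          ENNReal.tsum_le_tsum fun v ↦ mul_le_mul_right (ih v) _
      _ ≤ _ := by rw [ENNReal.tsum_mul_right]; exact mul_le_mul_left (h n u) _

/-! ### Moments and monotonicity of the kernel Q -/

/-- The mean of `ρ`. -/
def meanRho (p a : ℝ) : ℝ := p * ((1 - a) / a) + (1 - p) * (a / (1 - a))

/-- The second moment of `ρ`. -/
def sqRho (p a : ℝ) : ℝ := p * ((1 - a) / a) ^ 2 + (1 - p) * (a / (1 - a)) ^ 2

/-- The excess over 1 is (p-a)(1-2a)/(a(1-a)). This is where a < p enters essentially: it puts the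
walk in the zero-speed regime, although it remains transient. -/
theorem one_le_meanRho (h1 : p < 1 / 2) (ha0 : 0 < a) (hap : a < p) :
    1 ≤ meanRho p a := by
  have ha : 0 < 1 - a := by linarith
  have : meanRho p a - 1 = (p - a) * (1 - 2 * a) / (a * (1 - a)) := by
    rw [meanRho]; field_simp; ring
  have h2 : 0 ≤ (p - a) * (1 - 2 * a) / (a * (1 - a)) :=
    div_nonneg (mul_nonneg (by linarith) (by linarith)) (by positivity)
  linarith

theorem Q_nonneg (h0 : 0 ≤ p) (h1 : p ≤ 1) (ha : a ∈ Ioo (0 : ℝ) 1) (u v : ℕ) :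
    0 ≤ Q (temkin p a) u v := by
  rw [Q_temkin h0 h1 ha]
  have h2 := nbMass_nonneg ha.1 ha.2 u v
  have h3 := nbMass_nonneg (w := 1 - a) (by linarith [ha.2]) (by linarith [ha.1]) u v
  have h4 : 0 ≤ 1 - p := by linarith
  positivity

theorem hasSum_Q_quadratic (h0 : 0 ≤ p) (h1 : p ≤ 1) (ha : a ∈ Ioo (0 : ℝ) 1) (u : ℕ)
    (b0 b1 b2 : ℝ) : HasSum (fun v : ℕ ↦ Q (temkin p a) u v * (b0 + b1 * v + b2 * (v : ℝ) ^ 2))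
      (b0 + b1 * ((u + 1) * meanRho p a)
        + b2 * ((u + 1) * ((u + 2) * sqRho p a + meanRho p a))) := by
  have s1 := (hasSum_nbMass_quadratic ha.1 ha.2 u b0 b1 b2).mul_left p
  have s2 := (hasSum_nbMass_quadratic (w := 1 - a) (by linarith [ha.2]) (by linarith [ha.1])
    u b0 b1 b2).mul_left (1 - p)
  refine hasSum_of_eq (s1.add s2) (fun v ↦ ?_) ?_
  · rw [Q_temkin h0 h1 ha]; ring
  · rw [meanRho, sqRho, sub_sub_cancel]; ring

theorem hasSum_Q (h0 : 0 ≤ p) (h1 : p ≤ 1) (ha : a ∈ Ioo (0 : ℝ) 1) (u : ℕ) :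
    HasSum (fun v : ℕ ↦ Q (temkin p a) u v) 1 := by
  simpa using hasSum_Q_quadratic h0 h1 ha u 1 0 0

theorem summable_Q_mul (h0 : 0 ≤ p) (h1 : p ≤ 1) (ha : a ∈ Ioo (0 : ℝ) 1) (u : ℕ)
    {g : ℕ → ℝ} (hg : ∀ v, g v ∈ Icc (0 : ℝ) 1) :
    Summable fun v ↦ Q (temkin p a) u v * g v :=
  (hasSum_Q h0 h1 ha u).summable.of_nonneg_of_le
    (fun v ↦ mul_nonneg (Q_nonneg h0 h1 ha u v) (hg v).1)
    (fun v ↦ mul_le_of_le_one_right (Q_nonneg h0 h1 ha u v) (hg v).2)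

theorem tsum_Q_mul_mem_Icc (h0 : 0 ≤ p) (h1 : p ≤ 1) (ha : a ∈ Ioo (0 : ℝ) 1) (u : ℕ)
    {g : ℕ → ℝ} (hg : ∀ v, g v ∈ Icc (0 : ℝ) 1) :
    ∑' v, Q (temkin p a) u v * g v ∈ Icc (0 : ℝ) 1 := by
  refine ⟨tsum_nonneg fun v ↦ mul_nonneg (Q_nonneg h0 h1 ha u v) (hg v).1, ?_⟩
  rw [← (hasSum_Q h0 h1 ha u).tsum_eq]
  exact (summable_Q_mul h0 h1 ha u hg).tsum_le_tsum
    (fun v ↦ mul_le_of_le_one_right (Q_nonneg h0 h1 ha u v) (hg v).2)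
    (hasSum_Q h0 h1 ha u).summable

theorem antitone_tsum_Q (h0 : 0 ≤ p) (h1 : p ≤ 1) (ha : a ∈ Ioo (0 : ℝ) 1)
    {g : ℕ → ℝ} (hg : ∀ v, g v ∈ Icc (0 : ℝ) 1) (hga : Antitone g) :
    Antitone fun u ↦ ∑' v, Q (temkin p a) u v * g v := by
  have hb0 : 0 < 1 - a := by linarith [ha.2]
  have hb1 : 1 - a < 1 := by linarith [ha.1]
  have h2 : 0 ≤ 1 - p := by linarith
  have e : ∀ u, ∑' v, Q (temkin p a) u v * g v
      = p * ∑' v, nbMass a u v * g v + (1 - p) * ∑' v, nbMass (1 - a) u v * g v := by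
    intro u
    rw [← tsum_mul_left, ← tsum_mul_left,
      ← ((summable_nbMass_mul ha.1 ha.2 u hg).mul_left p).tsum_add
        ((summable_nbMass_mul hb0 hb1 u hg).mul_left (1 - p))]
    refine tsum_congr fun v ↦ ?_
    rw [Q_temkin h0 h1 ha]; ring
  intro u u' huu
  simp only [e]
  have m1 := antitone_tsum_nbMass ha.1 ha.2 hg hga huu
  have m2 := antitone_tsum_nbMass hb0 hb1 hg hga huu
  simp only at m1 m2
  gcongr

/-! ### Superlinear growth of the total number of left steps -/

/-- The Laplace transform at `t` of `Z_0 + ⋯ + Z_{m-1}`, where `Z` is the chain with kernel `Q`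
started at `u`. -/
def chainLaplace (p a t : ℝ) : ℕ → ℕ → ℝ
  | 0, _ => 1
  | m + 1, u => Real.exp (-(t * u)) * ∑' v, Q (temkin p a) u v * chainLaplace p a t m v

theorem chainLaplace_mem_Icc_and_antitone (h0 : 0 ≤ p) (h1 : p ≤ 1) (ha : a ∈ Ioo (0 : ℝ) 1)
    {t : ℝ} (ht : 0 ≤ t) (m : ℕ) :
    (∀ u, chainLaplace p a t m u ∈ Icc (0 : ℝ) 1) ∧ Antitone (chainLaplace p a t m) := by
  induction m with
  | zero => exact ⟨fun u ↦ by simp [chainLaplace], fun _ _ _ ↦ le_rfl⟩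
  | succ m ih =>
    have hI := fun u ↦ tsum_Q_mul_mem_Icc h0 h1 ha u ih.1
    refine ⟨fun u ↦ ⟨mul_nonneg (Real.exp_pos _).le (hI u).1,
      mul_le_one₀ (Real.exp_le_one_iff.2 (neg_nonpos.2 (by positivity))) (hI u).1 (hI u).2⟩,
      fun u u' huu ↦ ?_⟩
    have hcast : (u : ℝ) ≤ u' := by exact_mod_cast huu
    exact mul_le_mul (Real.exp_le_exp.2 (neg_le_neg (by gcongr)))
      (antitone_tsum_Q h0 h1 ha ih.1 ih.2 huu) (hI u').1 (Real.exp_pos _).le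

theorem chainSum_eq_chainLaplace (h0 : 0 ≤ p) (h1 : p ≤ 1) (ha : a ∈ Ioo (0 : ℝ) 1)
    {t : ℝ} (ht : 0 ≤ t) (m u : ℕ) :
    chainSum (fun _ u v ↦ ENNReal.ofReal (Q (temkin p a) u v) * ENNReal.ofReal (Real.exp (-(t * u))))
      m u = ENNReal.ofReal (chainLaplace p a t m u) := by
  induction m generalizing u with
  | zero => simp [chainSum, chainLaplace]
  | succ m ih =>
    have hI := (chainLaplace_mem_Icc_and_antitone h0 h1 ha ht m).1
    rw [chainSum, chainLaplace, ENNReal.ofReal_mul (Real.exp_pos _).le,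
      ENNReal.ofReal_tsum_of_nonneg (fun v ↦ mul_nonneg (Q_nonneg h0 h1 ha u v) (hI v).1)
        (summable_Q_mul h0 h1 ha u hI), ← ENNReal.tsum_mul_left]
    refine tsum_congr fun v ↦ ?_
    rw [ih, ENNReal.ofReal_mul (Q_nonneg h0 h1 ha u v)]
    ring

/-- Whatever state the chain has reached after j steps, it lies above 0, and the transform of the
remaining m values is antitone in the starting state. Restarting from 0 therefore only increases it,
which replaces independence of successive blocks. -/
theorem chainLaplace_add_le (h0 : 0 ≤ p) (h1 : p ≤ 1) (ha : a ∈ Ioo (0 : ℝ) 1)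
    {t : ℝ} (ht : 0 ≤ t) (m j u : ℕ) :
    chainLaplace p a t (m + j) u ≤ chainLaplace p a t m 0 * chainLaplace p a t j u := by
  have hI := fun m ↦ (chainLaplace_mem_Icc_and_antitone h0 h1 ha ht m).1
  induction j generalizing u with
  | zero =>
    simpa [chainLaplace] using
      (chainLaplace_mem_Icc_and_antitone h0 h1 ha ht m).2 (Nat.zero_le u)
  | succ j ih =>
    rw [← add_assoc, chainLaplace, chainLaplace, mul_left_comm]
    refine mul_le_mul_of_nonneg_left ?_ (Real.exp_pos _).le
    rw [← tsum_mul_left]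
    have s := (summable_Q_mul h0 h1 ha u (hI j)).mul_left (chainLaplace p a t m 0)
    refine (summable_Q_mul h0 h1 ha u (hI (m + j))).tsum_le_tsum (fun v ↦ ?_) s
    rw [mul_left_comm]
    exact mul_le_mul_of_nonneg_left (ih v) (Q_nonneg h0 h1 ha u v)

theorem chainLaplace_mul_add_le (h0 : 0 ≤ p) (h1 : p ≤ 1) (ha : a ∈ Ioo (0 : ℝ) 1)
    {t : ℝ} (ht : 0 ≤ t) (m B r : ℕ) :
    chainLaplace p a t (m * B + r) 0 ≤ chainLaplace p a t m 0 ^ B := by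
  have hI := fun m ↦ (chainLaplace_mem_Icc_and_antitone h0 h1 ha ht m).1
  induction B with
  | zero => simpa using (hI r 0).2
  | succ B ih =>
    rw [show m * (B + 1) + r = m + (m * B + r) by ring, pow_succ']
    exact (chainLaplace_add_le h0 h1 ha ht m _ 0).trans
      (mul_le_mul_of_nonneg_left ih (hI m 0).1)

theorem exp_neg_le_quadratic {x : ℝ} (hx : 0 ≤ x) : Real.exp (-x) ≤ 1 - x + x ^ 2 := by
  have h1 := Real.add_one_le_exp x
  rw [Real.exp_neg, inv_le_iff_one_le_mul₀ (Real.exp_pos x)]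
  have h2 : 0 ≤ 1 - x + x ^ 2 := by nlinarith [sq_nonneg (x - 1)]
  calc (1 : ℝ) ≤ (1 - x + x ^ 2) * (x + 1) := by nlinarith [pow_nonneg hx 3]
    _ ≤ _ := by gcongr

/-- Second-order expansion of the Laplace transform. When `E ρ ≥ 1`, the mean of
`Z_0 + ⋯ + Z_{m-1}` grows at least quadratically. -/
theorem exists_chainLaplace_bounds (h0 : 0 ≤ p) (h1 : p ≤ 1) (ha : a ∈ Ioo (0 : ℝ) 1)
    (hmean : 1 ≤ meanRho p a) (m : ℕ) :
    ∃ A0 A1 B0 B1 B2 : ℝ, (m * (m - 1) / 2 : ℝ) ≤ A0 ∧ m ≤ A1 ∧ ∀ t, 0 ≤ t → ∀ u : ℕ,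
      1 - t * (A0 + A1 * u) ≤ chainLaplace p a t m u ∧
      chainLaplace p a t m u
        ≤ 1 - t * (A0 + A1 * u) + t ^ 2 * (B0 + B1 * u + B2 * (u : ℝ) ^ 2) := by
  induction m with
  | zero => exact ⟨0, 0, 0, 0, 0, by simp, by simp, fun t ht u ↦ by simp [chainLaplace]⟩
  | succ m ih =>
    obtain ⟨A0, A1, B0, B1, B2, hA0, hA1, hb⟩ := ih
    set μ := meanRho p a with hμ
    set σ := sqRho p a with hσ
    have hA1' : 0 ≤ A1 := le_trans (by positivity) hA1
    -- `A0 + A1 * u` is the mean of the sum: one step replaces v by its mean (u+1)μ and adds the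
    -- current value u. As μ ≥ 1, `A1` grows at least like m and `A0` like m(m-1)/2. The quadratic
    -- coefficients collect the second moment (u+1)((u+2)σ+μ), the cross term with t·u, and (t·u)²
    -- from the exponential.
    refine ⟨A0 + A1 * μ, 1 + A1 * μ, B0 + B1 * μ + B2 * (2 * σ + μ),
      B1 * μ + B2 * (3 * σ + μ) + (A0 + A1 * μ), B2 * σ + A1 * μ + 1, ?_, ?_, fun t ht u ↦ ?_⟩
    · push_cast; nlinarith
    · push_cast; nlinarith
    · have hI := (chainLaplace_mem_Icc_and_antitone h0 h1 ha ht m).1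
      have hG := tsum_Q_mul_mem_Icc h0 h1 ha u hI
      have hs := summable_Q_mul h0 h1 ha u hI
      rw [chainLaplace]
      set G := ∑' v, Q (temkin p a) u v * chainLaplace p a t m v with hGdef
      have hlow : 1 - t * (A0 + A1 * ((u + 1) * μ)) ≤ G := by
        have := hasSum_le (fun v : ℕ ↦ mul_le_mul_of_nonneg_left
          ((le_of_eq (by ring : (1 - t * A0) + (-t * A1) * (v : ℝ) + 0 * (v : ℝ) ^ 2
            = 1 - t * (A0 + A1 * v))).trans (hb t ht v).1) (Q_nonneg h0 h1 ha u v))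
          (hasSum_Q_quadratic h0 h1 ha u (1 - t * A0) (-t * A1) 0) hs.hasSum
        linarith
      have hup : G ≤ 1 - t * (A0 + A1 * ((u + 1) * μ)) + t ^ 2 * (B0 + B1 * ((u + 1) * μ)
          + B2 * ((u + 1) * ((u + 2) * σ + μ))) := by
        have := hasSum_le (fun v : ℕ ↦ mul_le_mul_of_nonneg_left ((hb t ht v).2.trans
          (le_of_eq (by ring : _ = (1 - t * A0 + t ^ 2 * B0) + (-t * A1 + t ^ 2 * B1) * (v : ℝ)
            + (t ^ 2 * B2) * (v : ℝ) ^ 2))) (Q_nonneg h0 h1 ha u v)) hs.hasSum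
          (hasSum_Q_quadratic h0 h1 ha u (1 - t * A0 + t ^ 2 * B0) (-t * A1 + t ^ 2 * B1)
            (t ^ 2 * B2))
        refine this.trans (le_of_eq ?_)
        ring
      have hu : (0 : ℝ) ≤ t * u := by positivity
      have he1 := Real.one_sub_le_exp_neg (t * u)
      have he2 := exp_neg_le_quadratic hu
      constructor
      · have : (1 - t * u) * G ≤ Real.exp (-(t * u)) * G := mul_le_mul_of_nonneg_right he1 hG.1
        have h3 : t * u * G ≤ t * u * 1 := mul_le_mul_of_nonneg_left hG.2 hu
        calc _ = 1 - t * (A0 + A1 * ((u + 1) * μ)) - t * u * 1 := by ring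
          _ ≤ G - t * u * G := by linarith
          _ = (1 - t * u) * G := by ring
          _ ≤ _ := this
      · have h3 : Real.exp (-(t * u)) * G ≤ (1 - t * u + (t * u) ^ 2) * G :=
          mul_le_mul_of_nonneg_right he2 hG.1
        have h4 : t * u * (1 - t * (A0 + A1 * ((u + 1) * μ))) ≤ t * u * G :=
          mul_le_mul_of_nonneg_left hlow hu
        have h5 : (t * u) ^ 2 * G ≤ (t * u) ^ 2 * 1 := mul_le_mul_of_nonneg_left hG.2 (by positivity)
        calc _ ≤ (1 - t * u + (t * u) ^ 2) * G := h3
          _ = G - t * u * G + (t * u) ^ 2 * G := by ring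
          _ ≤ (1 - t * (A0 + A1 * ((u + 1) * μ)) + t ^ 2 * (B0 + B1 * ((u + 1) * μ)
              + B2 * ((u + 1) * ((u + 2) * σ + μ))))
              - t * u * (1 - t * (A0 + A1 * ((u + 1) * μ))) + (t * u) ^ 2 * 1 := by linarith
          _ = _ := by ring

theorem exists_chainLaplace_le (h0 : 0 ≤ p) (h1 : p ≤ 1) (ha : a ∈ Ioo (0 : ℝ) 1)
    (hmean : 1 ≤ meanRho p a) {M : ℝ} (hM : 0 ≤ M) :
    ∃ m : ℕ, 0 < m ∧ ∃ t : ℝ, 0 < t ∧ chainLaplace p a t m 0 ≤ Real.exp (-(t * (M * m))) := by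
  -- This makes m(m-1)/2 ≥ (M+1)m, so the mean of a block exceeds M·m by m to spare. The choice t =
  -- m/(|B0|+1) below keeps the quadratic correction t²·B0 under t·m.
  obtain ⟨m, hm⟩ := exists_nat_ge (2 * (M + 1) + 1)
  have hm0 : (0 : ℝ) < m := by linarith
  obtain ⟨A0, A1, B0, B1, B2, hA0, -, hb⟩ := exists_chainLaplace_bounds h0 h1 ha hmean m
  refine ⟨m, by exact_mod_cast hm0, m / (|B0| + 1), by positivity, ?_⟩
  set t : ℝ := m / (|B0| + 1) with ht
  have ht0 : 0 < t := by positivity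
  have h := (hb t ht0.le 0).2
  simp only [Nat.cast_zero, mul_zero, add_zero, ne_eq, OfNat.ofNat_ne_zero, not_false_eq_true,
    zero_pow] at h
  have h2 : t * B0 ≤ m := by
    rw [ht, div_mul_eq_mul_div, div_le_iff₀ (by positivity)]
    have := le_abs_self B0
    nlinarith
  have h3 : (M + 1) * m ≤ A0 := by nlinarith
  have h4 := Real.one_sub_le_exp_neg (t * (M * m))
  nlinarith [mul_le_mul_of_nonneg_left h2 ht0.le, mul_le_mul_of_nonneg_left h3 ht0.le]

theorem tendsto_exp_mul_chainLaplace (h0 : 0 ≤ p) (h1 : p ≤ 1) (ha : a ∈ Ioo (0 : ℝ) 1)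
    (hmean : 1 ≤ meanRho p a) {M : ℝ} (hM : 0 ≤ M) : ∃ t : ℝ, 0 < t ∧
      Tendsto (fun n : ℕ ↦ Real.exp (t * (M * n)) * chainLaplace p a t n 0) atTop (𝓝 0) := by
  -- Using M + 1 in place of M leaves a factor exp(-t·n) after splitting n into blocks of length m;
  -- the incomplete block costs only a constant.
  obtain ⟨m, hm, t, ht, hle⟩ := exists_chainLaplace_le h0 h1 ha hmean (M := M + 1) (by linarith)
  refine ⟨t, ht, ?_⟩
  have hI := fun m ↦ (chainLaplace_mem_Icc_and_antitone h0 h1 ha ht.le m).1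
  have hlim : Tendsto (fun n : ℕ ↦ Real.exp (-(t * n - t * (M + 1) * m))) atTop (𝓝 0) := by
    refine Real.tendsto_exp_neg_atTop_nhds_zero.comp ?_
    refine tendsto_atTop_add_const_right _ _ ?_
    exact tendsto_natCast_atTop_atTop.const_mul_atTop ht
  refine squeeze_zero (fun n ↦ mul_nonneg (Real.exp_pos _).le (hI n 0).1) (fun n ↦ ?_) hlim
  have h2 : chainLaplace p a t n 0 ≤ Real.exp (-(t * ((M + 1) * m))) ^ (n / m) := by
    have := chainLaplace_mul_add_le h0 h1 ha ht.le m (n / m) (n % m)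
    rw [Nat.div_add_mod] at this
    exact this.trans (pow_le_pow_left₀ (hI m 0).1 hle _)
  rw [← Real.exp_nat_mul] at h2
  refine (mul_le_mul_of_nonneg_left h2 (Real.exp_pos _).le).trans ?_
  rw [← Real.exp_add]
  refine Real.exp_le_exp.2 ?_
  have h3 : (n : ℝ) ≤ m * (n / m : ℕ) + m := by
    have h4 := Nat.div_add_mod n m
    have h5 := Nat.mod_lt n hm
    have : n ≤ m * (n / m) + m := by omega
    exact_mod_cast this
  have h6 : t * (M + 1) * n ≤ t * (M + 1) * (m * (n / m : ℕ) + m) :=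
    mul_le_mul_of_nonneg_left h3 (by positivity)
  nlinarith

/-- Markov's inequality carried out on the chain: the indicator of {1 ≤ F} is at most F, and F sees
only the first n coordinates and the boundary value L_n = 0. -/
theorem annealedLaw_one_le_le_tsum (h0 : 0 < p) (h1 : p < 1 / 2) (ha0 : 0 < a)
    (ha1 : a < 1 / 2) {n : ℕ} (hn : 0 < n) {F : (ℕ → ℕ) → ℝ≥0∞}
    (hF : ∀ f g : ℕ → ℕ, (∀ y ≤ n, f y = g y) → F f = F g) :
    annealedLaw (temkin p a) {X | 1 ≤ F (leftSteps X n)}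
      ≤ ∑' ℓ : Fin n → ℕ, F (extendTuple ℓ 0) * ∏ y ∈ Finset.range n, ENNReal.ofReal
          (Q (temkin p a) (extendTuple ℓ 0 (y + 1)) (extendTuple ℓ 0 y)) := by
  refine le_trans (measure_mono_ae ?_) ((annealedLaw_leftSteps_mem_le h0 h1 ha0 ha1 hn
    {ℓ | 1 ≤ F (extendTuple ℓ 0)}).trans (ENNReal.tsum_le_tsum fun ℓ ↦ ?_))
  · filter_upwards [ae_annealedLaw_leftSteps_self h0 h1 ha0 ha1 hn] with X hX h
    have h : 1 ≤ F (leftSteps X n) := h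
    show 1 ≤ F _
    rwa [← hF _ _ hX]
  · by_cases h : ℓ ∈ {ℓ : Fin n → ℕ | 1 ≤ F (extendTuple ℓ 0)}
    · rw [indicator_of_mem h]
      exact le_mul_of_one_le_left zero_le h
    · rw [indicator_of_notMem h]
      exact zero_le

/-- A Chernoff bound. The exponential weights sit on L_n = 0, L_{n-1}, …, L_1, that is, on the first
n values of the chain started at 0, so the bound is exp(t·M·n) times the Laplace transform. -/
theorem tendsto_annealedLaw_sum_leftSteps_le (h0 : 0 < p) (h1 : p < 1 / 2) (ha0 : 0 < a)
    (hap : a < p) {M : ℝ} (hM : 0 ≤ M) :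
    Tendsto (fun n : ℕ ↦ annealedLaw (temkin p a)
      {X | ∑ y ∈ Finset.range n, (leftSteps X n (y + 1) : ℝ) ≤ M * n}) atTop (𝓝 0) := by
  have ha : a ∈ Ioo (0 : ℝ) 1 := ⟨ha0, by linarith⟩
  have hp1 : p ≤ 1 := by linarith
  obtain ⟨t, ht, hlim⟩ := tendsto_exp_mul_chainLaplace h0.le hp1 ha (one_le_meanRho h1 ha0 hap) hM
  have hlim' := ENNReal.tendsto_ofReal hlim
  rw [ENNReal.ofReal_zero] at hlim'
  refine tendsto_of_tendsto_of_tendsto_of_le_of_le' tendsto_const_nhds hlim'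
    (Eventually.of_forall fun _ ↦ zero_le) ?_
  filter_upwards [eventually_gt_atTop 0] with n hn
  let F : (ℕ → ℕ) → ℝ≥0∞ := fun f ↦ ENNReal.ofReal (Real.exp (t * (M * n)))
    * ∏ y ∈ Finset.range n, ENNReal.ofReal (Real.exp (-(t * f (y + 1))))
  have hF : ∀ f g : ℕ → ℕ, (∀ y ≤ n, f y = g y) → F f = F g := fun f g h ↦ by
    simp only [F]
    congr 1
    refine Finset.prod_congr rfl fun y hy ↦ ?_
    rw [h _ (Finset.mem_range.1 hy)]
  calc annealedLaw (temkin p a) {X | ∑ y ∈ Finset.range n, (leftSteps X n (y + 1) : ℝ) ≤ M * n}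
      ≤ annealedLaw (temkin p a) {X | 1 ≤ F (leftSteps X n)} := by
        refine measure_mono fun X (hX : _ ≤ M * n) ↦ ?_
        show 1 ≤ F _
        simp only [F]
        rw [← ENNReal.ofReal_prod_of_nonneg (fun _ _ ↦ (Real.exp_pos _).le),
          ← ENNReal.ofReal_mul (Real.exp_pos _).le, ← Real.exp_sum, ← Real.exp_add,
          ← ENNReal.ofReal_one]
        refine ENNReal.ofReal_le_ofReal (Real.one_le_exp ?_)
        rw [Finset.sum_neg_distrib, ← Finset.mul_sum]
        nlinarith
    _ ≤ _ := annealedLaw_one_le_le_tsum h0 h1 ha0 (by linarith) hn hF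
    _ = _ := by
        rw [ENNReal.ofReal_mul (Real.exp_pos _).le, ← chainSum_eq_chainLaplace h0.le hp1 ha ht.le,
          ← tsum_prod_eq_chainSum, ← ENNReal.tsum_mul_left]
        refine tsum_congr fun ℓ ↦ ?_
        rw [mul_assoc, ← Finset.prod_mul_distrib]
        congr 1
        exact Finset.prod_congr rfl fun y _ ↦ mul_comm _ _

/-! ### Fluctuations around the conditional means -/

/-- The normalized squared deviation of `v` from the closest of the two conditional means
`ρ (u + 1)`. -/
def deviation (a : ℝ) (u v : ℕ) : ℝ :=
  min (((v : ℝ) - (1 - a) / a * (u + 1)) ^ 2) (((v : ℝ) - a / (1 - a) * (u + 1)) ^ 2) / (u + 1)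

theorem deviation_nonneg (a : ℝ) (u v : ℕ) : 0 ≤ deviation a u v := by
  unfold deviation; positivity

/-- On each component of the mixture the minimum is bounded by the square centred at that
component's own mean. The negative binomial variance is (ρ+ρ²)(u+1), so the normalization makes the
bound independent of u. -/
theorem tsum_Q_mul_deviation_le (h0 : 0 ≤ p) (h1 : p ≤ 1) (ha : a ∈ Ioo (0 : ℝ) 1) (u : ℕ) :
    ∑' v, ENNReal.ofReal (Q (temkin p a) u v) * ENNReal.ofReal (deviation a u v)
      ≤ ENNReal.ofReal (meanRho p a + sqRho p a) := by
  have hb0 : 0 < 1 - a := by linarith [ha.2]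
  have hb1 : 1 - a < 1 := by linarith [ha.1]
  have h2 : 0 ≤ 1 - p := by linarith
  have hu : (0 : ℝ) < u + 1 := by positivity
  have s1 := ((hasSum_nbMass_variance ha.1 ha.2 u).mul_left (p / (u + 1)))
  have s2 := ((hasSum_nbMass_variance hb0 hb1 u).mul_left ((1 - p) / (u + 1)))
  have s : HasSum (fun v : ℕ ↦ p / (u + 1) * (nbMass a u v * ((v : ℝ) - (1 - a) / a * (u + 1)) ^ 2)
      + (1 - p) / (u + 1) * (nbMass (1 - a) u v * ((v : ℝ) - a / (1 - a) * (u + 1)) ^ 2))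
      (meanRho p a + sqRho p a) := by
    rw [sub_sub_cancel] at s2
    refine hasSum_of_eq (s1.add s2) (fun v ↦ rfl) ?_
    rw [meanRho, sqRho]
    field_simp
    ring
  have n1 := fun v ↦ nbMass_nonneg ha.1 ha.2 u v
  have n2 := fun v ↦ nbMass_nonneg hb0 hb1 u v
  rw [← s.tsum_eq, ENNReal.ofReal_tsum_of_nonneg _ s.summable]
  · refine ENNReal.tsum_le_tsum fun v ↦ ?_
    rw [← ENNReal.ofReal_mul (Q_nonneg h0 h1 ha u v), Q_temkin h0 h1 ha, deviation]
    refine ENNReal.ofReal_le_ofReal ?_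
    have e1 : min (((v : ℝ) - (1 - a) / a * (u + 1)) ^ 2) (((v : ℝ) - a / (1 - a) * (u + 1)) ^ 2)
        / (u + 1) ≤ ((v : ℝ) - (1 - a) / a * (u + 1)) ^ 2 / (u + 1) := by
      gcongr; exact min_le_left _ _
    have e2 : min (((v : ℝ) - (1 - a) / a * (u + 1)) ^ 2) (((v : ℝ) - a / (1 - a) * (u + 1)) ^ 2)
        / (u + 1) ≤ ((v : ℝ) - a / (1 - a) * (u + 1)) ^ 2 / (u + 1) := by
      gcongr; exact min_le_right _ _
    calc _ ≤ p * nbMass a u v * (((v : ℝ) - (1 - a) / a * (u + 1)) ^ 2 / (u + 1))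
          + (1 - p) * nbMass (1 - a) u v * (((v : ℝ) - a / (1 - a) * (u + 1)) ^ 2 / (u + 1)) := by
          rw [add_mul]
          exact add_le_add (mul_le_mul_of_nonneg_left e1 (mul_nonneg h0 (n1 v)))
            (mul_le_mul_of_nonneg_left e2 (mul_nonneg h2 (n2 v)))
      _ = _ := by ring
  · intro v
    have := n1 v
    have := n2 v
    positivity

theorem annealedLaw_le_sum_deviation (h0 : 0 < p) (h1 : p < 1 / 2) (ha0 : 0 < a)
    (ha1 : a < 1 / 2) {n : ℕ} (hn : 0 < n) {K : ℝ} (hK : 0 < K) :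
    annealedLaw (temkin p a) {X | K * n
        ≤ ∑ y ∈ Finset.range n, deviation a (leftSteps X n (y + 1)) (leftSteps X n y)}
      ≤ ENNReal.ofReal ((meanRho p a + sqRho p a) / K) := by
  have ha : a ∈ Ioo (0 : ℝ) 1 := ⟨ha0, by linarith⟩
  have hp1 : p ≤ 1 := by linarith
  have hn' : (0 : ℝ) < n := by exact_mod_cast hn
  set c := ENNReal.ofReal (meanRho p a + sqRho p a) with hc
  let F : (ℕ → ℕ) → ℝ≥0∞ := fun f ↦ ENNReal.ofReal (K * n)⁻¹
    * ∑ x ∈ Finset.range n, ENNReal.ofReal (deviation a (f (x + 1)) (f x))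
  have hF : ∀ f g : ℕ → ℕ, (∀ y ≤ n, f y = g y) → F f = F g := fun f g h ↦ by
    simp only [F]
    congr 1
    refine Finset.sum_congr rfl fun y hy ↦ ?_
    have := Finset.mem_range.1 hy
    rw [h _ this, h _ this.le]
  calc annealedLaw (temkin p a) {X | K * n
        ≤ ∑ y ∈ Finset.range n, deviation a (leftSteps X n (y + 1)) (leftSteps X n y)}
      ≤ annealedLaw (temkin p a) {X | 1 ≤ F (leftSteps X n)} := by
        refine measure_mono fun X (hX : K * n ≤ _) ↦ ?_
        show 1 ≤ F _
        simp only [F]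
        rw [← ENNReal.ofReal_sum_of_nonneg (fun _ _ ↦ deviation_nonneg _ _ _),
          ← ENNReal.ofReal_mul (by positivity), ← ENNReal.ofReal_one]
        refine ENNReal.ofReal_le_ofReal ?_
        rw [inv_mul_eq_div, one_le_div (by positivity)]
        exact hX
    _ ≤ _ := annealedLaw_one_le_le_tsum h0 h1 ha0 ha1 hn hF
    _ = ENNReal.ofReal (K * n)⁻¹ * ∑ x ∈ Finset.range n, ∑' ℓ : Fin n → ℕ,
          ∏ y ∈ Finset.range n, (ENNReal.ofReal
            (Q (temkin p a) (extendTuple ℓ 0 (y + 1)) (extendTuple ℓ 0 y)) * if y = x then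
            ENNReal.ofReal (deviation a (extendTuple ℓ 0 (y + 1)) (extendTuple ℓ 0 y)) else 1) := by
        rw [← Summable.tsum_finsetSum (fun _ _ ↦ ENNReal.summable), ← ENNReal.tsum_mul_left]
        refine tsum_congr fun ℓ ↦ ?_
        simp only [F]
        rw [mul_assoc, Finset.sum_mul]
        congr 1
        refine Finset.sum_congr rfl fun x hx ↦ ?_
        rw [Finset.prod_mul_distrib, Finset.prod_ite_eq' (Finset.range n) x, if_pos hx, mul_comm]
    _ ≤ ENNReal.ofReal (K * n)⁻¹ * ∑ x ∈ Finset.range n, c := by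
        -- The x-th term is the mass of a chain with kernel Q at every step except x, where the
        -- kernel is weighted by the deviation. All steps have mass 1 except that one, of mass at
        -- most `c`.
        refine mul_le_mul_right (Finset.sum_le_sum fun x hx ↦ ?_) _
        rw [tsum_prod_eq_chainSum (fun y u v ↦ ENNReal.ofReal (Q (temkin p a) u v)
          * if y = x then ENNReal.ofReal (deviation a u v) else 1)]
        refine (chainSum_le (c := fun y ↦ if y = x then c else 1) (fun y u ↦ ?_) n 0).trans ?_
        · by_cases hy : y = x
          · simp only [hy, if_true]
            exact tsum_Q_mul_deviation_le h0.le hp1 ha u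
          · simp only [hy, if_false, mul_one]
            rw [← ENNReal.ofReal_tsum_of_nonneg (Q_nonneg h0.le hp1 ha u)
              (hasSum_Q h0.le hp1 ha u).summable, (hasSum_Q h0.le hp1 ha u).tsum_eq,
              ENNReal.ofReal_one]
        · rw [Finset.prod_ite_eq' (Finset.range n) x, if_pos hx]
    _ = _ := by
        rw [Finset.sum_const, Finset.card_range, nsmul_eq_mul, ← mul_assoc,
          ← ENNReal.ofReal_natCast n, ← ENNReal.ofReal_mul (by positivity), hc,
          ← ENNReal.ofReal_mul (by positivity)]
        congr 1
        field_simp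

/-! ### Part (a): divergence of the criterion and consistency -/

/-- The difference of the two sides is a square over a positive number. This trades half of a linear
drift αU for control of a fluctuation of order √U. -/
theorem mul_abs_le {C α U d : ℝ} (hα : 0 < α) (hU : 0 < U) :
    C * |d| ≤ α / 2 * U + C ^ 2 / (2 * α) * (d ^ 2 / U) := by
  have : α / 2 * U + C ^ 2 / (2 * α) * (d ^ 2 / U) - C * |d|
      = (α * U - C * |d|) ^ 2 / (2 * α * U) := by
    rw [← sq_abs d]
    field_simp
    ring
  have h2 : 0 ≤ (α * U - C * |d|) ^ 2 / (2 * α * U) := by positivity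
  linarith

variable {Θ : Set ℝ}

/-- Away from the true parameter, the log-likelihood ratio is at most a negative multiple of `u`,
up to a term of bounded expectation. -/
theorem exists_phi_sub_phi_le (h0 : 0 < p) (h1 : p < 1 / 2) (hΘ : IsCompact Θ)
    (hΘp : Θ ⊆ Ioo 0 p) {b : ℝ} (hb : b ∈ Θ) {α : ℝ} (hα : 0 < α) :
    ∃ C₀ C₁ : ℝ, 0 ≤ C₁ ∧ ∀ θ ∈ Θ, α < dKL b θ → ∀ u v : ℕ,
      phi (temkin p θ) u v - phi (temkin p b) u v
        ≤ C₀ - α / 2 * (u + 1) + C₁ * deviation b u v := by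
  have hpos : ∀ θ ∈ Θ, 0 < θ ∧ θ < 1 / 2 := fun θ hθ ↦ ⟨(hΘp hθ).1, (hΘp hθ).2.trans h1⟩
  obtain ⟨hb0, hb1⟩ := hpos b hb
  have hb2 : 0 < 1 - b := by linarith
  -- Compactness makes the Lipschitz constant uniform in θ, so the final bound passes to the
  -- supremum over θ.
  obtain ⟨C, hC⟩ := hΘ.exists_bound_of_continuousOn
    (f := fun θ ↦ |Real.log (θ / b)| + |Real.log ((1 - θ) / (1 - b))|) (by
      refine ContinuousOn.add (ContinuousOn.abs (ContinuousOn.log (by fun_prop) ?_))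
        (ContinuousOn.abs (ContinuousOn.log (by fun_prop) ?_))
      · exact fun θ hθ ↦ (div_pos (hpos θ hθ).1 hb0).ne'
      · exact fun θ hθ ↦ (div_pos (by linarith [(hpos θ hθ).2]) hb2).ne')
  refine ⟨Real.log (1 / p), C ^ 2 / (2 * α), by positivity, fun θ hθ hd u v ↦ ?_⟩
  have hu : (0 : ℝ) < u + 1 := by positivity
  have hw : ∀ w, w = b ∨ w = 1 - b → phi (temkin p θ) u v - phi (temkin p b) u v
      ≤ Real.log (1 / p) - α / 2 * (u + 1)
        + C ^ 2 / (2 * α) * (((v : ℝ) - (1 - w) / w * (u + 1)) ^ 2 / (u + 1)) := by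
    intro w hw
    refine (phi_sub_phi_le_dKL h0 h1 (hpos θ hθ).1 (hpos θ hθ).2 hb0 hb1 hw u v).trans ?_
    have e1 : (|Real.log (θ / b)| + |Real.log ((1 - θ) / (1 - b))|)
        * |(v : ℝ) - (1 - w) / w * (u + 1)| ≤ C * |(v : ℝ) - (1 - w) / w * (u + 1)| := by
      gcongr
      exact (le_abs_self _).trans (hC θ hθ)
    have e2 := mul_abs_le (C := C) (d := (v : ℝ) - (1 - w) / w * (u + 1)) hα hu
    have e3 : α * ((u : ℝ) + 1) ≤ dKL b θ * (u + 1) := by gcongr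
    linarith
  -- The bound holds with either site type as centre, hence with the one realizing the minimum in
  -- `deviation`; the hidden type need not be known.
  have k1 := hw b (Or.inl rfl)
  have k2 := hw (1 - b) (Or.inr rfl)
  rw [sub_sub_cancel] at k2
  rw [deviation]
  rcases min_choice (((v : ℝ) - (1 - b) / b * (u + 1)) ^ 2)
    (((v : ℝ) - b / (1 - b) * (u + 1)) ^ 2) with h | h <;> rw [h] <;> assumption

theorem ereal_coe_sum {ι : Type*} (s : Finset ι) (f : ι → ℝ) :
    ((∑ i ∈ s, f i : ℝ) : EReal) = ∑ i ∈ s, (f i : EReal) := by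
  classical
  induction s using Finset.induction_on with
  | empty => simp
  | insert i s hi ih => rw [Finset.sum_insert hi, Finset.sum_insert hi, EReal.coe_add, ih]

theorem supCriterion_le {A : Set ℝ} {b : ℝ} {n : ℕ} {X : ℕ → ℤ} {g : ℕ → ℕ → ℝ}
    (h : ∀ θ ∈ A, ∀ u v, phi (temkin p θ) u v - phi (temkin p b) u v ≤ g u v) :
    supCriterion (temkin p) b A n X
      ≤ (((n : ℝ)⁻¹ * ∑ x ∈ Finset.range n, g (leftSteps X n (x + 1)) (leftSteps X n x) : ℝ)
        : EReal) := by
  rw [supCriterion, EReal.coe_mul, ereal_coe_sum]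
  refine mul_le_mul_of_nonneg_left (Finset.sum_le_sum fun x _ ↦ ?_)
    (EReal.coe_nonneg.2 (by positivity))
  exact iSup₂_le fun θ hθ ↦ EReal.coe_le_coe_iff.2 (h θ hθ _ _)

theorem le_supCriterion {A : Set ℝ} {b θ : ℝ} (hθ : θ ∈ A) (n : ℕ) (X : ℕ → ℤ) :
    (((n : ℝ)⁻¹ * ∑ x ∈ Finset.range n, (phi (temkin p θ) (leftSteps X n (x + 1)) (leftSteps X n x)
      - phi (temkin p b) (leftSteps X n (x + 1)) (leftSteps X n x)) : ℝ) : EReal)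
      ≤ supCriterion (temkin p) b A n X := by
  rw [supCriterion, EReal.coe_mul, ereal_coe_sum]
  refine mul_le_mul_of_nonneg_left (Finset.sum_le_sum fun x _ ↦ ?_)
    (EReal.coe_nonneg.2 (by positivity))
  exact le_iSup₂_of_le θ hθ le_rfl

theorem tendsto_annealedLaw_lt_supCriterion (h0 : 0 < p) (h1 : p < 1 / 2) (hΘ : IsCompact Θ)
    (hΘp : Θ ⊆ Ioo 0 p) {b : ℝ} (hb : b ∈ Θ) {α : ℝ} (hα : 0 < α) (M : ℝ) :
    Tendsto (fun n : ℕ ↦ annealedLaw (temkin p b) {X | (M : EReal) < supCriterion (temkin p) b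
      (Θ \ {a | a ∈ Θ ∧ dKL b a ≤ α}) n X}) atTop (𝓝 0) := by
  obtain ⟨C₀, C₁, hC₁, hbound⟩ := exists_phi_sub_phi_le h0 h1 hΘ hΘp hb hα
  have hb0 := (hΘp hb).1
  have hbp := (hΘp hb).2
  have hb1 : b < 1 / 2 := hbp.trans h1
  set D := meanRho p b + sqRho p b with hD
  refine ENNReal.tendsto_nhds_zero.2 fun ε hε ↦ ?_
  obtain ⟨δ, hδ0, hδ⟩ := ENNReal.lt_iff_exists_nnreal_btwn.1 (ENNReal.half_pos hε.ne')
  have hδ0' : (0 : ℝ) < δ := by exact_mod_cast hδ0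
  -- `K` makes the total deviation exceed K·n with probability at most ε/2. Then `M'` is such that
  -- the drift α/2·M' compensates |C₀|, C₁·K and the target level |M|.
  set K : ℝ := (|D| + 1) / δ with hK
  have hK0 : 0 < K := by positivity
  set M' : ℝ := 2 / α * (|C₀| + C₁ * K + |M|) with hM'
  have hM0 : 0 ≤ M' := by positivity
  filter_upwards [ENNReal.tendsto_nhds_zero.1
    (tendsto_annealedLaw_sum_leftSteps_le h0 h1 hb0 hbp hM0) (ε / 2) (ENNReal.half_pos hε.ne'),
    eventually_gt_atTop 0] with n hn hn0
  have hn0' : (0 : ℝ) < n := by exact_mod_cast hn0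
  have hdev : annealedLaw (temkin p b) {X | K * n
        ≤ ∑ y ∈ Finset.range n, deviation b (leftSteps X n (y + 1)) (leftSteps X n y)} ≤ ε / 2 := by
    refine (annealedLaw_le_sum_deviation h0 h1 hb0 hb1 hn0 hK0).trans (le_trans ?_ hδ.le)
    rw [← ENNReal.ofReal_coe_nnreal]
    refine ENNReal.ofReal_le_ofReal ?_
    rw [hK, div_div_eq_mul_div, div_le_iff₀ (by positivity)]
    nlinarith [le_abs_self D]
  calc _ ≤ annealedLaw (temkin p b)
          ({X | ∑ y ∈ Finset.range n, (leftSteps X n (y + 1) : ℝ) ≤ M' * n} ∪ {X | K * n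
            ≤ ∑ y ∈ Finset.range n, deviation b (leftSteps X n (y + 1)) (leftSteps X n y)}) := by
        refine measure_mono fun X hX ↦ ?_
        by_contra hcon
        simp only [mem_union, mem_ofPred_eq, not_or, not_le] at hcon
        obtain ⟨k1, k2⟩ := hcon
        have h3 := (show (M : EReal) < _ from hX).trans_le (supCriterion_le (n := n) (X := X)
          (g := fun u v ↦ C₀ - α / 2 * (u + 1) + C₁ * deviation b u v)
          fun θ hθ u v ↦ hbound θ hθ.1 (by
            by_contra hh
            exact hθ.2 ⟨hθ.1, not_lt.1 hh⟩) u v)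
        rw [EReal.coe_lt_coe_iff] at h3
        refine absurd h3 (not_lt.2 ?_)
        rw [inv_mul_le_iff₀ hn0', Finset.sum_add_distrib, Finset.sum_sub_distrib,
          ← Finset.mul_sum, ← Finset.mul_sum, Finset.sum_add_distrib]
        simp only [Finset.sum_const, Finset.card_range, nsmul_eq_mul, mul_one]
        have k3 : α / 2 * (M' * n) ≤ α / 2 * (∑ y ∈ Finset.range n, (leftSteps X n (y + 1) : ℝ)) := by
          gcongr
        have k4 : C₁ * (∑ y ∈ Finset.range n, deviation b (leftSteps X n (y + 1)) (leftSteps X n y))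
            ≤ C₁ * (K * n) := by gcongr
        have k5 : α / 2 * (M' * n) = (|C₀| + C₁ * K + |M|) * n := by
          rw [hM']; field_simp
        have k6 := mul_le_mul_of_nonneg_right (le_abs_self C₀) hn0'.le
        have k7 := mul_le_mul_of_nonneg_right (neg_abs_le M) hn0'.le
        have k8 : 0 < α / 2 * n := by positivity
        nlinarith
    _ ≤ ε / 2 + ε / 2 := (measure_union_le _ _).trans (add_le_add hn hdev)
    _ = ε := ENNReal.add_halves ε

/-- The divergence from b is continuous and positive on the compact set of parameters at distance at
least ε from b, so it has a positive minimum there; half of it serves as α. -/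
theorem exists_dist_lt_of_dKL_le (h1 : p < 1 / 2) (hΘ : IsCompact Θ) (hΘp : Θ ⊆ Ioo 0 p) {b : ℝ}
    (hb : b ∈ Θ) {ε : ℝ} (hε : 0 < ε) :
    ∃ α, 0 < α ∧ ∀ θ ∈ Θ, dKL b θ ≤ α → dist θ b < ε := by
  have hpos : ∀ θ ∈ Θ, θ ∈ Ioo (0 : ℝ) 1 := fun θ hθ ↦ ⟨(hΘp hθ).1, by linarith [(hΘp hθ).2]⟩
  set T : Set ℝ := Θ ∩ {θ | ε ≤ dist θ b} with hT
  have hTc : IsCompact T := hΘ.inter_right (isClosed_le continuous_const (by fun_prop))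
  have hcont : ContinuousOn (fun θ ↦ dKL b θ) T := by
    unfold dKL
    have hb' := hpos b hb
    refine ContinuousOn.add (ContinuousOn.mul continuousOn_const (ContinuousOn.log
      (ContinuousOn.div continuousOn_const continuousOn_id ?_) ?_))
      (ContinuousOn.mul continuousOn_const (ContinuousOn.log
      (ContinuousOn.div continuousOn_const (by fun_prop) ?_) ?_))
    · exact fun θ hθ ↦ (hpos θ hθ.1).1.ne'
    · exact fun θ hθ ↦ (div_pos hb'.1 (hpos θ hθ.1).1).ne'
    · exact fun θ hθ ↦ by linarith [(hpos θ hθ.1).2]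
    · exact fun θ hθ ↦ (div_pos (by linarith [hb'.2]) (by linarith [(hpos θ hθ.1).2])).ne'
  rcases T.eq_empty_or_nonempty with he | hne
  · refine ⟨1, one_pos, fun θ hθ _ ↦ ?_⟩
    by_contra! hh
    exact (he ▸ (⟨hθ, hh⟩ : θ ∈ T) : θ ∈ (∅ : Set ℝ))
  · obtain ⟨θ₁, hθ₁, hmin⟩ := hTc.exists_isMinOn hne hcont
    have hne' : b ≠ θ₁ := by
      rintro rfl
      have h2 : ε ≤ dist b b := hθ₁.2
      rw [dist_self] at h2
      linarith
    have hp1 := (dKL_nonneg_and_pos (hpos b hb) (hpos θ₁ hθ₁.1)).2 hne'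
    refine ⟨dKL b θ₁ / 2, by linarith, fun θ hθ hd ↦ ?_⟩
    by_contra! hh
    have : dKL b θ₁ ≤ dKL b θ := hmin ⟨hθ, hh⟩
    linarith

/-- Changing the reference θ₀ shifts the criterion by a quantity independent of the parameter. A
maximizer thus has nonnegative likelihood ratio against b; if it is far from b, the supremum outside
a Kullback-Leibler neighbourhood is nonnegative, hence above -1, which has vanishing probability. -/
theorem tendstoInMeasure_of_isMaxOn_criterion (h0 : 0 < p) (h1 : p < 1 / 2) (hΘ : IsCompact Θ)
    (hΘp : Θ ⊆ Ioo 0 p) {b : ℝ} (hb : b ∈ Θ) {θ₀ : ℝ} {θhat : ℕ → (ℕ → ℤ) → ℝ}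
    (hmax : ∀ n, ∀ᵐ X ∂(annealedLaw (temkin p b)),
      θhat n X ∈ Θ ∧ IsMaxOn (criterion (temkin p) θ₀ n X) Θ (θhat n X)) :
    TendstoInMeasure (annealedLaw (temkin p b)) θhat atTop (fun _ ↦ b) := by
  refine tendstoInMeasure_iff_dist.2 fun ε hε ↦ ?_
  obtain ⟨α, hα, hd⟩ := exists_dist_lt_of_dKL_le h1 hΘ hΘp hb hε
  refine tendsto_of_tendsto_of_tendsto_of_le_of_le tendsto_const_nhds
    (tendsto_annealedLaw_lt_supCriterion h0 h1 hΘ hΘp hb hα (-1)) (fun _ ↦ zero_le) fun n ↦ ?_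
  refine measure_mono_ae ?_
  filter_upwards [hmax n] with X ⟨hmem, hm⟩ hdist
  have hdist : ε ≤ dist (θhat n X) b := hdist
  have hout : θhat n X ∈ Θ \ {a | a ∈ Θ ∧ dKL b a ≤ α} :=
    ⟨hmem, fun hh ↦ absurd (hd _ hh.1 hh.2) (not_lt.2 hdist)⟩
  refine lt_of_lt_of_le ?_ (le_supCriterion hout n X)
  rw [EReal.coe_lt_coe_iff]
  have hcmp : criterion (temkin p) θ₀ n X b ≤ criterion (temkin p) θ₀ n X (θhat n X) := hm hb
  rw [criterion, criterion, ← sub_nonneg, ← Finset.sum_sub_distrib] at hcmp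
  simp only [sub_sub_sub_cancel_right] at hcmp
  have : 0 ≤ (n : ℝ)⁻¹ * ∑ x ∈ Finset.range n,
      (phi (temkin p (θhat n X)) (leftSteps X n (x + 1)) (leftSteps X n x)
      - phi (temkin p b) (leftSteps X n (x + 1)) (leftSteps X n x)) := by positivity
  linarith

/-! ### The invariant law has infinite mean -/

theorem S_mem_Icc (ω : Env) : S ω ∈ Icc (0 : ℝ) 1 := by
  have hnn : ∀ k : ℕ, 0 ≤ ∏ i ∈ Finset.Icc 1 k, rho ω (i : ℤ) := fun k ↦
    Finset.prod_nonneg fun i _ ↦ (rho_pos ω i).le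
  refine ⟨inv_nonneg.2 (tsum_nonneg hnn), ?_⟩
  by_cases hs : Summable fun k : ℕ ↦ ∏ i ∈ Finset.Icc 1 k, rho ω (i : ℤ)
  · refine inv_le_one_of_one_le₀ ?_
    have := hs.le_tsum 0 (fun k _ ↦ hnn k)
    simpa using this
  -- For a divergent series the sum defaults to 0, and so does its inverse, which agrees with the
  -- convention 1/∞ = 0.
  · rw [S, tsum_eq_zero_of_not_summable hs]; simp

theorem S_pos {ω : Env} (hs : Summable fun k : ℕ ↦ ∏ i ∈ Finset.Icc 1 k, rho ω (i : ℤ)) :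
    0 < S ω :=
  inv_pos.2 (hs.tsum_pos (fun k ↦ Finset.prod_nonneg fun i _ ↦ (rho_pos ω i).le) 0 (by simp))

theorem measurable_rho (x : ℤ) : Measurable fun ω : Env ↦ rho ω x := by
  unfold rho; fun_prop

theorem measurable_prod_rho (k : ℕ) :
    Measurable fun ω : Env ↦ ∏ i ∈ Finset.Icc 1 k, rho ω (i : ℤ) :=
  Finset.measurable_prod _ fun i _ ↦ measurable_rho i

theorem measurable_S : Measurable S := by
  have h : Measurable fun ω : Env ↦ ∑' k : ℕ, ∏ i ∈ Finset.Icc 1 k, rho ω (i : ℤ) :=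
    Measurable.tsum measurable_prod_rho
  exact h.inv

theorem ofReal_piInv {ν : Measure (Ioo (0 : ℝ) 1)} [IsProbabilityMeasure ν] (u : ℕ) :
    ENNReal.ofReal (piInv ν u) = ∫⁻ ω, ENNReal.ofReal (S ω * (1 - S ω) ^ u) ∂(envLaw ν) := by
  have : IsProbabilityMeasure (envLaw ν) := by unfold envLaw; infer_instance
  have hm : Measurable fun ω ↦ S ω * (1 - S ω) ^ u :=
    measurable_S.mul ((measurable_const.sub measurable_S).pow_const u)
  have h0 : ∀ ω, 0 ≤ S ω * (1 - S ω) ^ u := fun ω ↦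
    mul_nonneg (S_mem_Icc ω).1 (pow_nonneg (by linarith [(S_mem_Icc ω).2]) u)
  refine ofReal_integral_eq_lintegral_ofReal ?_ (ae_of_all _ h0)
  refine Integrable.of_bound hm.aestronglyMeasurable 1 (ae_of_all _ fun ω ↦ ?_)
  rw [Real.norm_of_nonneg (h0 ω)]
  exact mul_le_one₀ (S_mem_Icc ω).2 (pow_nonneg (by linarith [(S_mem_Icc ω).2]) u)
    (pow_le_one₀ (by linarith [(S_mem_Icc ω).2]) (by linarith [(S_mem_Icc ω).1]))

theorem measurable_S_mul_pow (u : ℕ) :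
    Measurable fun ω ↦ ENNReal.ofReal (S ω * (1 - S ω) ^ u) :=
  (measurable_S.mul ((measurable_const.sub measurable_S).pow_const u)).ennreal_ofReal

/-- For S > 0 the weights S(1-S)^u form a geometric law. For S = 0 they vanish, so no summability of
the ρ-series is needed for this inequality. -/
theorem tsum_piInv_le_one {ν : Measure (Ioo (0 : ℝ) 1)} [IsProbabilityMeasure ν] :
    ∑' u, ENNReal.ofReal (piInv ν u) ≤ 1 := by
  have : IsProbabilityMeasure (envLaw ν) := by unfold envLaw; infer_instance
  simp only [ofReal_piInv]
  rw [← lintegral_tsum fun u ↦ (measurable_S_mul_pow u).aemeasurable]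
  calc _ ≤ ∫⁻ _, 1 ∂(envLaw ν) := by
        refine lintegral_mono fun ω ↦ ?_
        obtain ⟨h0, h1⟩ := S_mem_Icc ω
        rcases h0.eq_or_lt with h | h
        · simp [← h]
        · have hs := (hasSum_geometric_of_lt_one (r := 1 - S ω) (by linarith)
            (by linarith)).mul_left (S ω)
          show ∑' u, ENNReal.ofReal (S ω * (1 - S ω) ^ u) ≤ 1
          rw [← ENNReal.ofReal_tsum_of_nonneg (fun u ↦ mul_nonneg h0 (pow_nonneg (by linarith) u))
            hs.summable, hs.tsum_eq, sub_sub_cancel, mul_inv_cancel₀ h.ne', ENNReal.ofReal_one]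
    _ = 1 := by simp

theorem lintegral_prod_rho_temkin (h0 : 0 ≤ p) (h1 : p ≤ 1) (ha : a ∈ Ioo (0 : ℝ) 1) (k : ℕ) :
    ∫⁻ ω, ENNReal.ofReal (∏ i ∈ Finset.Icc 1 k, rho ω (i : ℤ)) ∂(envLaw (temkin p a))
      = ENNReal.ofReal (meanRho p a) ^ k := by
  have := isProbabilityMeasure_temkin h0 h1 ha
  have h := lintegral_env_prod (ν := temkin p a) (e := fun i : ℕ ↦ (i : ℤ) + 1)
    (fun i j hij ↦ by simpa using hij) (f := fun _ y ↦ ENNReal.ofReal ((1 - (y : ℝ)) / y))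
    (fun _ ↦ by fun_prop) k
  have h3 : 0 < 1 - a := by linarith [ha.2]
  have h4 : 0 ≤ 1 - p := by linarith
  have h5 := ha.1
  rw [lintegral_temkin ha, reflect, ← ENNReal.ofReal_mul h0, ← ENNReal.ofReal_mul h4,
    sub_sub_cancel, ← ENNReal.ofReal_add (by positivity) (by positivity), Finset.prod_const,
    Finset.card_range] at h
  rw [meanRho, ← h]
  refine lintegral_congr fun ω ↦ ?_
  rw [prod_Icc_rho, ENNReal.ofReal_prod_of_nonneg fun i _ ↦ (rho_pos ω _).le]
  rfl

/-- The invariant law has an infinite mean. -/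
theorem tsum_piInv_mul_succ (h0 : 0 < p) (h1 : p < 1 / 2) (ha0 : 0 < a) (hap : a < p) :
    ∑' u : ℕ, ENNReal.ofReal (piInv (temkin p a) u) * ENNReal.ofReal (u + 1) = ⊤ := by
  have ha : a ∈ Ioo (0 : ℝ) 1 := ⟨ha0, by linarith⟩
  have hp1 : p ≤ 1 := by linarith
  have := isProbabilityMeasure_temkin h0.le hp1 ha
  simp only [ofReal_piInv]
  simp only [← lintegral_mul_const _ (measurable_S_mul_pow _)]
  rw [← lintegral_tsum fun u ↦ ((measurable_S_mul_pow u).mul_const _).aemeasurable]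
  -- The mean of u + 1 under the geometric law with parameter S is 1/S, which is the ρ-series. By
  -- independence its expectation is a sum of powers of E ρ ≥ 1.
  have key : ∀ᵐ ω ∂(envLaw (temkin p a)),
      ∑' u : ℕ, ENNReal.ofReal (S ω * (1 - S ω) ^ u) * ENNReal.ofReal (u + 1)
        = ∑' k : ℕ, ENNReal.ofReal (∏ i ∈ Finset.Icc 1 k, rho ω (i : ℤ)) := by
    filter_upwards [ae_summable_prod_rho h0 h1 ha0 (by linarith)] with ω hω
    have hS := S_pos hω
    have hS1 := (S_mem_Icc ω).2
    have hprod := ENNReal.ofReal_tsum_of_nonneg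
      (fun k : ℕ ↦ Finset.prod_nonneg fun (i : ℕ) (_ : i ∈ Finset.Icc 1 k) ↦ (rho_pos ω i).le) hω
    have hn : ‖1 - S ω‖ < 1 := by rw [Real.norm_of_nonneg (by linarith)]; linarith
    have hs := (hasSum_choose_mul_geometric_of_norm_lt_one 1 hn).mul_left (S ω)
    rw [sub_sub_cancel] at hs
    have hs' : HasSum (fun u : ℕ ↦ S ω * (1 - S ω) ^ u * ((u : ℝ) + 1))
        (∑' k : ℕ, ∏ i ∈ Finset.Icc 1 k, rho ω (i : ℤ)) := by
      refine hasSum_of_eq hs (fun u ↦ ?_) ?_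
      · rw [Nat.choose_one_right]; push_cast; ring
      · have : ∑' k : ℕ, ∏ i ∈ Finset.Icc 1 k, rho ω (i : ℤ) = (S ω)⁻¹ := by rw [S, inv_inv]
        rw [this]; field_simp
    have hpow : ∀ u : ℕ, 0 ≤ S ω * (1 - S ω) ^ u := fun u ↦
      mul_nonneg hS.le (pow_nonneg (by linarith) u)
    rw [← hprod, ← hs'.tsum_eq, ENNReal.ofReal_tsum_of_nonneg
      (fun u ↦ mul_nonneg (hpow u) (by positivity)) hs'.summable]
    exact tsum_congr fun u ↦ (ENNReal.ofReal_mul (hpow u)).symm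
  rw [lintegral_congr_ae key, lintegral_tsum fun k ↦
    (measurable_prod_rho k).ennreal_ofReal.aemeasurable]
  simp only [lintegral_prod_rho_temkin h0.le hp1 ha]
  refine top_unique ?_
  calc (⊤ : ℝ≥0∞) = ∑' _ : ℕ, 1 := (ENNReal.tsum_const_eq_top_of_ne_zero one_ne_zero).symm
    _ ≤ _ := ENNReal.tsum_le_tsum fun k ↦ one_le_pow₀ (by
      rw [← ENNReal.ofReal_one]
      exact ENNReal.ofReal_le_ofReal (one_le_meanRho h1 ha0 hap))

theorem piInv_nonneg (ν : Measure (Ioo (0 : ℝ) 1)) (u : ℕ) : 0 ≤ piInv ν u :=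
  integral_nonneg fun ω ↦
    mul_nonneg (S_mem_Icc ω).1 (pow_nonneg (by linarith [(S_mem_Icc ω).2]) u)

/-! ### Parts (b) and (c): non-integrability -/

/-- The constant C costs at most a finite amount because π has mass at most 1, while the linear term
has infinite π-mean. -/
theorem expPiTilde_eq_top (h0 : 0 < p) (h1 : p < 1 / 2) (ha0 : 0 < a) (hap : a < p)
    {g : ℕ → ℕ → ℝ≥0∞} {c C : ℝ} (hc : 0 < c)
    (h : ∀ u : ℕ, ENNReal.ofReal (c * (u + 1) - C)
      ≤ ∑' v, ENNReal.ofReal (Q (temkin p a) u v) * g u v) :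
    expPiTilde (temkin p a) g = ⊤ := by
  have ha : a ∈ Ioo (0 : ℝ) 1 := ⟨ha0, by linarith⟩
  have := isProbabilityMeasure_temkin h0.le (by linarith) ha
  have hle : ENNReal.ofReal c * ∑' u : ℕ, ENNReal.ofReal (piInv (temkin p a) u)
      * ENNReal.ofReal (u + 1) ≤ expPiTilde (temkin p a) g + ENNReal.ofReal C := by
    calc _ = ∑' u : ℕ, ENNReal.ofReal (piInv (temkin p a) u) * ENNReal.ofReal (c * (u + 1)) := by
          rw [← ENNReal.tsum_mul_left]
          refine tsum_congr fun u ↦ ?_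
          rw [ENNReal.ofReal_mul hc.le]; ring
      _ ≤ ∑' u : ℕ, (∑' v, ENNReal.ofReal (piTilde (temkin p a) u v) * g u v
            + ENNReal.ofReal (piInv (temkin p a) u) * ENNReal.ofReal C) := by
          refine ENNReal.tsum_le_tsum fun u ↦ ?_
          simp only [piTilde, ENNReal.ofReal_mul (piInv_nonneg _ u), mul_assoc]
          rw [ENNReal.tsum_mul_left, ← mul_add]
          refine mul_le_mul_right (le_trans ?_ (add_le_add (h u) le_rfl)) _
          refine le_trans (ENNReal.ofReal_le_ofReal ?_) ENNReal.ofReal_add_le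
          linarith
      _ ≤ _ := by
          rw [ENNReal.tsum_add, expPiTilde, ENNReal.tsum_mul_right]
          exact add_le_add le_rfl (mul_le_of_le_one_left zero_le tsum_piInv_le_one)
  rw [tsum_piInv_mul_succ h0 h1 ha0 hap,
    ENNReal.mul_top (ENNReal.ofReal_pos.2 hc).ne', top_le_iff, ENNReal.add_eq_top] at hle
  exact hle.resolve_right ENNReal.ofReal_ne_top

theorem ofReal_le_tsum_of_hasSum {f : ℕ → ℝ} {s : ℝ} (h : HasSum f s) :
    ENNReal.ofReal s ≤ ∑' v, ENNReal.ofReal (f v) := by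
  by_cases ht : ∑' v, ENNReal.ofReal (f v) = ⊤
  · rw [ht]; exact le_top
  · have hs := ENNReal.summable_toReal ht
    refine ENNReal.ofReal_le_of_le_toReal ?_
    rw [ENNReal.tsum_toReal_eq fun v ↦ ENNReal.ofReal_ne_top, ← h.tsum_eq]
    refine h.summable.tsum_le_tsum (fun v ↦ ?_) hs
    rw [ENNReal.toReal_ofReal']
    exact le_max_left _ _

/-- Only the unfavourable component of the mixture, of weight p, is kept. The minorant `h` may be
negative, so its sum is taken over the reals before passing to `[0,∞]`. -/
theorem le_tsum_Q_mul (h0 : 0 ≤ p) (h1 : p ≤ 1) (ha : a ∈ Ioo (0 : ℝ) 1) {u : ℕ}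
    {g h : ℕ → ℝ} {s : ℝ} (hg : ∀ v, 0 ≤ g v) (hle : ∀ v, h v ≤ g v)
    (hs : HasSum (fun v ↦ nbMass a u v * h v) s) :
    ENNReal.ofReal (p * s) ≤ ∑' v, ENNReal.ofReal (Q (temkin p a) u v) * ENNReal.ofReal (g v) := by
  refine (ofReal_le_tsum_of_hasSum (hs.mul_left p)).trans (ENNReal.tsum_le_tsum fun v ↦ ?_)
  rw [← ENNReal.ofReal_mul (Q_nonneg h0 h1 ha u v)]
  refine ENNReal.ofReal_le_ofReal ?_
  have n1 := nbMass_nonneg ha.1 ha.2 u v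
  have n2 := nbMass_nonneg (w := 1 - a) (by linarith [ha.2]) (by linarith [ha.1]) u v
  have e1 : p * (nbMass a u v * h v) ≤ p * nbMass a u v * g v := by
    rw [mul_assoc]
    exact mul_le_mul_of_nonneg_left (mul_le_mul_of_nonneg_left (hle v) n1) h0
  have e2 : 0 ≤ (1 - p) * nbMass (1 - a) u v * g v :=
    mul_nonneg (mul_nonneg (by linarith) n2) (hg v)
  rw [Q_temkin h0 h1 ha, add_mul]
  linarith

/-- A function which grows linearly in `u` at sites of the unfavourable type is not integrable. -/
theorem expPiTilde_eq_top_of_linear_le (h0 : 0 < p) (h1 : p < 1 / 2) (ha0 : 0 < a) (hap : a < p)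
    {g : ℕ → ℕ → ℝ} {κ C D : ℝ} (hκ : 0 < κ) (hg : ∀ u v, 0 ≤ g u v)
    (hle : ∀ u v : ℕ, κ * (u + 1) - C
      - D * (((v : ℝ) - (1 - a) / a * (u + 1)) ^ 2 / (u + 1)) ≤ g u v) :
    expPiTilde (temkin p a) (fun u v ↦ ENNReal.ofReal (g u v)) = ⊤ := by
  have ha : a ∈ Ioo (0 : ℝ) 1 := ⟨ha0, by linarith⟩
  have hp1 : p ≤ 1 := by linarith
  set r := (1 - a) / a with hr
  refine expPiTilde_eq_top h0 h1 ha0 hap (c := p * κ) (C := |p * (C + D * (r + r ^ 2))|)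
    (by positivity) fun u ↦ ?_
  have hu : (u : ℝ) + 1 ≠ 0 := by positivity
  have hs : HasSum (fun v : ℕ ↦ nbMass a u v * (κ * (u + 1) - C
      - D * (((v : ℝ) - r * (u + 1)) ^ 2 / (u + 1)))) (κ * (u + 1) - C - D * (r + r ^ 2)) := by
    refine hasSum_of_eq (((hasSum_nbMass ha.1 ha.2 u).mul_left (κ * (u + 1) - C)).sub
      ((hasSum_nbMass_variance ha.1 ha.2 u).mul_left (D / (u + 1)))) (fun v ↦ by ring) ?_
    rw [← hr]
    field_simp
  refine le_trans (ENNReal.ofReal_le_ofReal ?_) (le_tsum_Q_mul h0.le hp1 ha (hg u) (hle u) hs)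
  have := le_abs_self (p * (C + D * (r + r ^ 2)))
  linarith

/-- At unfavourable sites under b, v is close to r(u+1), and the score at θ is close to κ(u+1), with
κ = 1/θ - r/(1-θ) = (b-θ)/(θb(1-θ)). This is nonzero exactly because θ ≠ b. -/
theorem expPiTilde_abs_phiDeriv (h0 : 0 < p) (h1 : p < 1 / 2) {b θ : ℝ} (hb0 : 0 < b) (hbp : b < p)
    (hθ0 : 0 < θ) (hθp : θ < p) (hne : θ ≠ b) :
    expPiTilde (temkin p b) (fun u v ↦ ENNReal.ofReal |phiDeriv (temkin p) θ u v|) = ⊤ := by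
  obtain ⟨C, hC, hbound⟩ := exists_abs_phiDeriv_sub_le h0 (by linarith : p < 1) hθ0 (by linarith)
  have hb1 : 0 < 1 - b := by linarith
  have hθ1 : 0 < 1 - θ := by linarith
  set r := (1 - b) / b with hr
  have hr1 : 0 < r - 1 := by
    have : r - 1 = (1 - 2 * b) / b := by rw [hr]; field_simp; ring
    rw [this]; exact div_pos (by linarith) hb0
  set κ := 1 / θ - r / (1 - θ) with hκ
  have hκ0 : κ ≠ 0 := by
    have : κ = (b - θ) / (θ * b * (1 - θ)) := by rw [hκ, hr]; field_simp; ring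
    rw [this]
    exact div_ne_zero (sub_ne_zero.2 hne.symm) (by positivity)
  have hκp : 0 < |κ| := abs_pos.2 hκ0
  refine expPiTilde_eq_top_of_linear_le h0 h1 hb0 hbp (κ := |κ| / 2) (C := C)
    (D := (1 / (1 - θ)) ^ 2 / (2 * |κ|) + C * (1 / (4 * (r - 1)))) (by positivity)
    (fun _ _ ↦ abs_nonneg _) fun u v ↦ ?_
  rw [← hr]
  have hU : (0 : ℝ) < u + 1 := by positivity
  set U : ℝ := (u : ℝ) + 1 with hUdef
  set d : ℝ := (v : ℝ) - r * U with hd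
  have hA : U / θ - v / (1 - θ) = κ * U - 1 / (1 - θ) * d := by
    rw [hd, hκ]; ring
  have e1 := hbound u v
  rw [← hUdef, hA] at e1
  have e2 : |κ| * U - 1 / (1 - θ) * |d| ≤ |κ * U - 1 / (1 - θ) * d| := by
    have := abs_sub_abs_le_abs_sub (κ * U) (1 / (1 - θ) * d)
    rw [abs_mul, abs_mul, abs_of_pos hU, abs_of_pos (by positivity : 0 < 1 / (1 - θ))] at this
    exact this
  have e3 := mul_abs_le (C := 1 / (1 - θ)) (d := d) hκp hU
  have e4 := mul_abs_le (C := 1) (d := d) (by linarith : 0 < 2 * (r - 1)) hU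
  -- Since r > 1, having v < U is a large deviation: U - v = -d - (r-1)U, and the negative drift
  -- turns the linear error into a multiple of d²/U.
  have e5 : max 0 (U - v) ≤ 1 / (4 * (r - 1)) * (d ^ 2 / U) := by
    refine max_le (by positivity) ?_
    have : U - v = -d - (r - 1) * U := by rw [hd]; ring
    rw [this]
    have h3 := neg_abs_le d
    have h4 : (1 : ℝ) ^ 2 / (2 * (2 * (r - 1))) = 1 / (4 * (r - 1)) := by
      rw [one_pow]; congr 1; ring
    rw [h4] at e4
    linarith
  have e6 := mul_le_mul_of_nonneg_left e5 hC
  have e7 := abs_sub_abs_le_abs_sub (κ * U - 1 / (1 - θ) * d) (phiDeriv (temkin p) θ u v)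
  rw [abs_sub_comm (κ * U - 1 / (1 - θ) * d) (phiDeriv (temkin p) θ u v)] at e7
  have e8 : ((1 / (1 - θ)) ^ 2 / (2 * |κ|) + C * (1 / (4 * (r - 1)))) * (d ^ 2 / U)
      = (1 / (1 - θ)) ^ 2 / (2 * |κ|) * (d ^ 2 / U) + C * (1 / (4 * (r - 1)) * (d ^ 2 / U)) := by ring
  rw [e8]
  linarith

/-- Under a parameter b ≠ θ₀ of Θ, the log-likelihood ratio of b against θ₀ at unfavourable sites is
at least d_KL(b|θ₀)/2·(u+1) up to integrable terms, and the supremum dominates it. -/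
theorem not_uniformlyIntegrableCriterion (h0 : 0 < p) (h1 : p < 1 / 2) {Θ : Set ℝ}
    (hΘp : Θ ⊆ Ioo 0 p) (hnt : Θ.Nontrivial) {θ₀ : ℝ} (hθ₀ : θ₀ ∈ Θ) :
    ¬ UniformlyIntegrableCriterion (temkin p) Θ θ₀ := by
  obtain ⟨b, hb, hne⟩ := hnt.exists_ne θ₀
  obtain ⟨hb0, hbp⟩ := hΘp hb
  obtain ⟨ht0, htp⟩ := hΘp hθ₀
  intro hui
  refine (hui b hb).ne (top_unique ?_)
  have hd := (dKL_nonneg_and_pos (a := b) (b := θ₀) ⟨hb0, by linarith⟩ ⟨ht0, by linarith⟩).2 hne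
  set C := |Real.log (θ₀ / b)| + |Real.log ((1 - θ₀) / (1 - b))| with hC
  have htop := expPiTilde_eq_top_of_linear_le h0 h1 hb0 hbp (κ := dKL b θ₀ / 2)
    (C := Real.log (1 / p)) (D := C ^ 2 / (2 * dKL b θ₀)) (by positivity)
    (g := fun u v ↦ |phi (temkin p b) u v - phi (temkin p θ₀) u v|) (fun _ _ ↦ abs_nonneg _)
    (fun u v ↦ by
      have e1 := phi_sub_phi_le_dKL h0 h1 ht0 (by linarith) hb0 (by linarith) (Or.inl rfl) u v
      have e2 := mul_abs_le (C := C) (d := (v : ℝ) - (1 - b) / b * (u + 1)) hd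
        (by positivity : (0 : ℝ) < u + 1)
      have e3 := le_abs_self (phi (temkin p b) u v - phi (temkin p θ₀) u v)
      linarith)
  rw [← htop]
  refine ENNReal.tsum_le_tsum fun u ↦ ENNReal.tsum_le_tsum fun v ↦ mul_le_mul_right ?_ _
  exact le_iSup₂_of_le b hb le_rfl

theorem fisherInformation_temkin (h0 : 0 < p) (h1 : p < 1 / 2) (ha0 : 0 < a) (hap : a < p) :
    fisherInformation (temkin p) a = ⊤ := by
  have ha : a ∈ Ioo (0 : ℝ) 1 := ⟨ha0, by linarith⟩
  have hp1 : p ≤ 1 := by linarith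
  have hb : 0 < 1 - a := by linarith
  obtain ⟨C, hC, hbound⟩ := exists_abs_phiDeriv_sub_le h0 (by linarith : p < 1) ha0 (by linarith)
  set r := (1 - a) / a with hr
  have hr0 : 0 < r := by positivity
  -- Base of a Chernoff bound for the event v < u + 1 under the unfavourable type. The generating
  -- function at `s`, divided by s^(u+1), is q^(u+1) with q = 4a(1-a) < 1, which beats the factor
  -- U².
  set s := 1 / (2 * (1 - a)) with hs
  have hs0 : 0 < s := by positivity
  have hs1 : s ≤ 1 := by rw [hs, div_le_one (by positivity)]; linarith
  set q := 4 * a * (1 - a) with hq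
  have hq0 : 0 < q := by positivity
  have hq1 : q < 1 := by nlinarith [sq_nonneg (1 - 2 * a), mul_pos ha0 (by linarith : 0 < 1 - 2 * a)]
  obtain ⟨B, hB⟩ := (tendsto_pow_const_mul_const_pow_of_abs_lt_one 2
    (by rw [abs_of_pos hq0]; exact hq1 : |q| < 1)).bddAbove_range
  have hB : ∀ n : ℕ, (n : ℝ) ^ 2 * q ^ n ≤ B := fun n ↦ hB ⟨n, rfl⟩
  refine expPiTilde_eq_top h0 h1 ha0 hap
    (c := p * ((r + r ^ 2) / (2 * (1 - a) ^ 2))) (C := |p * (C ^ 2 + B / (2 * a ^ 2))|)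
    (by positivity) fun u ↦ ?_
  set U : ℝ := (u : ℝ) + 1 with hU
  have hU0 : 0 < U := by positivity
  -- The minorant of the squared score: half the square of the unfavourable score, minus the bounded
  -- error `C ^ 2`, minus an exponential penalty for v < U, where the error is not bounded. Its mean
  -- is the normalized variance, linear in U, up to a bounded term.
  have hsum : HasSum (fun v : ℕ ↦ nbMass a u v * (((v : ℝ) - r * U) ^ 2 / (2 * (1 - a) ^ 2) - C ^ 2
      - U ^ 2 / (2 * a ^ 2) * (s ^ v / s ^ (u + 1))))
      ((r + r ^ 2) / (2 * (1 - a) ^ 2) * U - C ^ 2 - U ^ 2 * q ^ (u + 1) / (2 * a ^ 2)) := by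
    have hs' : (1 - a) * s = 1 / 2 := by rw [hs]; field_simp
    refine hasSum_of_eq ((((hasSum_nbMass_variance ha.1 ha.2 u).mul_left (1 / (2 * (1 - a) ^ 2))).sub
      ((hasSum_nbMass ha.1 ha.2 u).mul_left (C ^ 2))).sub
      ((hasSum_pow_mul_nbMass ha.2 hs0.le (by rw [hs']; norm_num) u).mul_left
        (U ^ 2 / (2 * a ^ 2) / s ^ (u + 1)))) (fun v ↦ by ring) ?_
    have : q ^ (u + 1) = (a / (1 - (1 - a) * s)) ^ (u + 1) / s ^ (u + 1) := by
      rw [← div_pow, hs', hq, hs]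
      congr 1
      field_simp
      norm_num
    rw [this, ← hr, ← hU]
    ring
  refine le_trans (ENNReal.ofReal_le_ofReal ?_) (le_tsum_Q_mul h0.le hp1 ha
    (fun v ↦ sq_nonneg (phiDeriv (temkin p) a u v)) (fun v ↦ ?_) hsum)
  · have h2 := hB (u + 1)
    push_cast at h2
    have h3 : U ^ 2 * q ^ (u + 1) / (2 * a ^ 2) ≤ B / (2 * a ^ 2) := by gcongr
    have h4 := le_abs_self (p * (C ^ 2 + B / (2 * a ^ 2)))
    have h5 := mul_le_mul_of_nonneg_left h3 h0.le
    calc _ ≤ p * ((r + r ^ 2) / (2 * (1 - a) ^ 2)) * U - p * (C ^ 2 + B / (2 * a ^ 2)) := by linarith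
      _ ≤ _ := by linarith
  · have hA : U / a - v / (1 - a) = -((v : ℝ) - r * U) / (1 - a) := by
      rw [hr]; field_simp; ring
    have e1 := hbound u v
    rw [← hU] at e1
    set A := U / a - v / (1 - a) with hAdef
    have hA2 : ((v : ℝ) - r * U) ^ 2 / (2 * (1 - a) ^ 2) = A ^ 2 / 2 := by
      rw [hA, div_pow, neg_sq]; field_simp
    rw [hA2]
    have hpos : 0 ≤ U ^ 2 / (2 * a ^ 2) * (s ^ v / s ^ (u + 1)) := by positivity
    rcases le_or_gt U v with h | h
    · rw [max_eq_left (by linarith), add_zero, mul_one] at e1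
      have e2 := sq_le_sq' (abs_le.1 e1).1 (abs_le.1 e1).2
      nlinarith [sq_nonneg (2 * phiDeriv (temkin p) a u v - A)]
    -- Here s^v/s^(u+1) ≥ 1, so the penalty alone exceeds A²/2 ≤ U²/(2a²). The minorant is then
    -- nonpositive, and nothing about the score is needed beyond its square being nonnegative.
    · have hvu : v ≤ u + 1 := by
        have : (v : ℝ) < (u + 1 : ℕ) := by push_cast; exact h
        exact_mod_cast this.le
      have h1' : 1 ≤ s ^ v / s ^ (u + 1) := by
        rw [one_le_div (by positivity)]
        exact pow_le_pow_of_le_one hs0.le hs1 hvu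
      have hA0 : 0 ≤ A := by
        rw [hAdef, sub_nonneg]
        exact div_le_div₀ hU0.le h.le ha0 (by linarith)
      have hA1 : A ≤ U / a := by
        rw [hAdef]
        have : 0 ≤ (v : ℝ) / (1 - a) := by positivity
        linarith
      have hA3 : A ^ 2 / 2 ≤ U ^ 2 / (2 * a ^ 2) * 1 := by
        calc A ^ 2 / 2 ≤ (U / a) ^ 2 / 2 := by gcongr
          _ = _ := by rw [div_pow]; field_simp
      have h7 : U ^ 2 / (2 * a ^ 2) * 1 ≤ U ^ 2 / (2 * a ^ 2) * (s ^ v / s ^ (u + 1)) := by gcongr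
      nlinarith [sq_nonneg (phiDeriv (temkin p) a u v), sq_nonneg C]

end RWRE

end

theorem proposition6 (p : ℝ) (hp : 0 < p) (hp' : p < 1 / 2)
    (Θ : Set ℝ) (hΘ : IsCompact Θ) (hΘp : Θ ⊆ Set.Ioo 0 p)
    (aStar : ℝ) (haStar : aStar ∈ Θ) :
    -- (a) the normalized criterion outside a Kullback-Leibler neighbourhood tends to `-∞` in
    -- probability,
    (∀ α : ℝ, 0 < α → ∀ M : ℝ,
      Filter.Tendsto
        (fun n : ℕ ↦ RWRE.annealedLaw (RWRE.temkin p aStar)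
          {X | (M : EReal) < RWRE.supCriterion (RWRE.temkin p) aStar
            (Θ \ {a | a ∈ Θ ∧ RWRE.dKL aStar a ≤ α}) n X})
        Filter.atTop (nhds 0)) ∧
    -- and every measurable choice of a maximum likelihood estimator is consistent
    (∀ θ₀ ∈ Θ, ∀ θhat : ℕ → (ℕ → ℤ) → ℝ, (∀ n, Measurable (θhat n)) →
      (∀ n, ∀ᵐ X ∂(RWRE.annealedLaw (RWRE.temkin p aStar)),
        θhat n X ∈ Θ ∧ IsMaxOn (RWRE.criterion (RWRE.temkin p) θ₀ n X) Θ (θhat n X)) →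
      MeasureTheory.TendstoInMeasure (RWRE.annealedLaw (RWRE.temkin p aStar)) θhat
        Filter.atTop (fun _ ↦ aStar)) ∧
    -- (b) infinite Fisher information
    (∀ θ ∈ Θ, RWRE.fisherInformation (RWRE.temkin p) θ = ⊤) ∧
    -- (c) non-integrability of the derivative at the wrong parameters
    (∀ θ ∈ Θ, θ ≠ aStar →
      RWRE.expPiTilde (RWRE.temkin p aStar)
        (fun u v ↦ ENNReal.ofReal |RWRE.phiDeriv (RWRE.temkin p) θ u v|) = ⊤) ∧
    -- and failure of the uniform integrability condition
    (Θ.Nontrivial → ∀ θ₀ ∈ Θ,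
      ¬ RWRE.UniformlyIntegrableCriterion (RWRE.temkin p) Θ θ₀) := by
  exact ⟨fun α hα M ↦ RWRE.tendsto_annealedLaw_lt_supCriterion hp hp' hΘ hΘp haStar hα M,
    fun _ _ _ _ hmax ↦ RWRE.tendstoInMeasure_of_isMaxOn_criterion hp hp' hΘ hΘp haStar hmax,
    fun _ hθ ↦ RWRE.fisherInformation_temkin hp hp' (hΘp hθ).1 (hΘp hθ).2,
    fun _ hθ hne ↦ RWRE.expPiTilde_abs_phiDeriv hp hp' (hΘp haStar).1 (hΘp haStar).2
      (hΘp hθ).1 (hΘp hθ).2 hne,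
    fun hnt _ hθ₀ ↦ RWRE.not_uniformlyIntegrableCriterion hp hp' hΘp hnt hθ₀⟩
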